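/- **Setting.** Let $\kappa\ge 1$ be an integer, $\mathscr X=\{0,1,\dots,\kappa\}^{\mathbb Z}$ with the product topology, $n>0$, and $p_n,q_n\ge 0$ with $p_n+q_n=1$ and $p_n\neq q_n$. Let $c,d:\{0,\dots,\kappa\}\to[0,\infty)$ satisfy $c(0)=d(0)=0$, $c(m)>0$ and $d(m)>0$ for $m\ne 0$, and $c(\kappa)=d(\kappa)$, and put $r(a,b)=c(a)\,d(\kappa-b)$. The partial exclusion process (PEP) is the Markov process $\eta=(\eta_x(t))_{x\in\mathbb Z,\,t\ge0}$ on $\mathscr X$ whose generator acts on functions $f$ depending on finitely many coordinates by $$L_nf(\eta)=n^2\sum_{x\in\mathbb Z}p_n\,r(\eta_x,\eta_{x+1})\big(f(\eta^{x,x+1})-f(\eta)\big)+n^2\sum_{x\in\mathbb Z}q_n\,r(\eta_x,\eta_{x-1})\big(f(\eta^{x,x-1})-f(\eta)\big),$$ where $\eta^{x,y}$ is $\eta$ after one particle has moved from $x$ to $y$; that is, its law is described by the unique strongly continuous Markov semigroup $(S(t))_{t\ge0}$ on $C(\mathscr X)$ whose infinitesimal generator (with limits in the supremum norm) equals $L_n$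 on these functions. A probability measure $\nu$ is invariant if $\int S(t)f\,d\nu=\int f\,d\nu$ for all $t\ge0$ and $f\in C(\mathscr X)$. For $\lambda>0$ let $\bar\nu_\lambda$ be the product measure on $\mathscr X$ with marginals $$\bar\nu_\lambda(\eta_x=m)=\frac1{Z_\lambda}\,\frac{\lambda^m}{c!(m)\,d!(\kappa-m)},\qquad 0\le m\le\kappa,$$ where $c!(m)=c(m)c(m-1)\cdots c(1)$, $c!(0)=1$, likewise for $d$, and $Z_\lambda$ is the normalizing constant. The map $\lambda\mapsto E_{\bar\nu_\lambda}[\eta_0]$ is a bijection from $(0,\infty)$ to $(0,\kappa)$; for $\rho\in(0,\kappa)$ let $\nu_\rho=\bar\nu_\lambda$ for the $\lambda$ with $E_{\bar\nu_\lambda}[\eta_0]=\rho$. The gradient condition is said to hold with $h:\{0,\dots,\kappa\}\to\mathbb R$ if the symmetric current satisfies $$W^S_{x,x+1}(\eta):=\tfrac12\big(r(\eta_x,\eta_{x+1})-r(\eta_{x+1},\eta_x)\big)=h(\eta_x)-h(\eta_{x+1})\quad\text{for all }x\in\mathbb Z,\ \eta\in\mathscr X,$$ and the process is of gradient type if it holds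 with some $h$. **Theorem.** In this setting the semigroup $(S(t))_{t\ge 0}$ exists and is unique, and the following are equivalent: 1. the product measure $\nu_\rho$ is invariant for the PEP for every $\rho\in(0,\kappa)$; 2. the PEP is of gradient type; 3. $d(\kappa-m)=c(\kappa)-c(m)$ for every $m\in\{0,\dots,\kappa\}$; 4. there is a function $g:\{0,\dots,\kappa\}\to[0,\infty)$ with $g(0)=0$, $g(\kappa)>0$ and $0<g(m)<g(\kappa)$ for $0<m<\kappa$, such that $r(a,b)=g(a)\,(g(\kappa)-g(b))$ for all $a,b\in\{0,\dots,\kappa\}$. Moreover, if condition 3 holds, then the gradient condition holds with $h(m)=\tfrac12c(\kappa)c(m)$, and for every $g$ as in condition 4 it holds with $h(m)=\tfrac12g(\kappa)g(m)$. -/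

import Mathlib

open MeasureTheory Filter Topology
open scoped NNReal

namespace PEP

/-- Configurations with at most `κ` particles per site of `ℤ`, with the product topology and the
product σ-algebra; `η x` is the number of particles at `x`. -/
abbrev Config (κ : ℕ) : Type := ℤ → Fin (κ + 1)

/-- The jump rate `r(a, b) = c(a) d(κ - b)`; note that `Fin.rev b = κ - b`. -/
def jumpRate {κ : ℕ} (c d : Fin (κ + 1) → ℝ) (a b : Fin (κ + 1)) : ℝ :=
  c a * d (Fin.rev b)

/-- The configuration `η^{x,y}` after one particle jumps from `x` to `y` (used for `x ≠ y`). A jump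
from an empty site or to a full site, which is not a configuration and has rate zero, is
suppressed. -/
def jump {κ : ℕ} (η : Config κ) (x y : ℤ) : Config κ :=
  if η x ≠ 0 ∧ η y ≠ Fin.last κ then
    Function.update (Function.update η x (η x - 1)) y (η y + 1)
  else η

/-- The discrete gradient `∇_{x,y} f (η) = f(η^{x,y}) - f(η)`. -/
def grad {κ : ℕ} (x y : ℤ) (f : Config κ → ℝ) (η : Config κ) : ℝ :=
  f (jump η x y) - f η

/-- A function is local if it depends on finitely many occupation variables only. -/
def IsLocal {κ : ℕ} (f : Config κ → ℝ) : Prop :=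
  ∃ A : Finset ℤ, DependsOn f (A : Set ℤ)

/-- The operator `L_n` of the partial exclusion process on local functions (for which only finitely
many terms of the two sums are nonzero). -/
noncomputable def generator {κ : ℕ} (n p q : ℝ) (r : Fin (κ + 1) → Fin (κ + 1) → ℝ)
    (f : Config κ → ℝ) (η : Config κ) : ℝ :=
  n ^ 2 * ∑' x : ℤ, p * r (η x) (η (x + 1)) * grad x (x + 1) f η +
    n ^ 2 * ∑' x : ℤ, q * r (η x) (η (x - 1)) * grad x (x - 1) f η

/-- A Markov (Feller) semigroup on the continuous functions of a compact space `X`. -/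
structure IsMarkovSemigroup {X : Type*} [TopologicalSpace X] [CompactSpace X]
    (S : ℝ≥0 → C(X, ℝ) →ₗ[ℝ] C(X, ℝ)) : Prop where
  zero : S 0 = LinearMap.id
  add : ∀ s t, S (s + t) = S s ∘ₗ S t
  one : ∀ t, S t 1 = 1
  nonneg : ∀ t f, 0 ≤ f → 0 ≤ S t f
  continuous : ∀ f, Continuous fun t => S t f

/-- `f` is in the domain of the infinitesimal generator of `S`, which maps `f` to `g`; the limit is
taken in the supremum norm. -/
def HasGenerator {X : Type*} [TopologicalSpace X] [CompactSpace X]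
    (S : ℝ≥0 → C(X, ℝ) →ₗ[ℝ] C(X, ℝ)) (f g : C(X, ℝ)) : Prop :=
  Tendsto (fun t : ℝ≥0 => (t : ℝ)⁻¹ • (S t f - f)) (𝓝[>] 0) (𝓝 g)

/-- `S` is the semigroup `S t f (η) = E_η[f(η(t))]` of the Markov process on `Config κ` generated
by `L_n`: a Markov semigroup whose infinitesimal generator is `L_n` on local functions. -/
structure IsPEPSemigroup {κ : ℕ} (n p q : ℝ) (r : Fin (κ + 1) → Fin (κ + 1) → ℝ)
    (S : ℝ≥0 → C(Config κ, ℝ) →ₗ[ℝ] C(Config κ, ℝ)) : Prop where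
  markov : IsMarkovSemigroup S
  generated : ∀ f : C(Config κ, ℝ), IsLocal f →
    ∃ g : C(Config κ, ℝ), (∀ η, g η = generator n p q r f η) ∧ HasGenerator S f g

/-- Invariance of `ν` under the dynamics with semigroup `S`, that is, `ν S(t) = ν` for all `t`. -/
def IsInvariant {κ : ℕ} (S : ℝ≥0 → C(Config κ, ℝ) →ₗ[ℝ] C(Config κ, ℝ))
    (ν : Measure (Config κ)) : Prop :=
  ∀ (t : ℝ≥0) (f : C(Config κ, ℝ)), ∫ η, S t f η ∂ν = ∫ η, f η ∂ν

/-- `g!(m) = g(m) g(m-1) ⋯ g(1)`, with `g!(0) = 1`. -/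
noncomputable def rateFactorial {κ : ℕ} (g : Fin (κ + 1) → ℝ) (m : Fin (κ + 1)) : ℝ :=
  ∏ j ∈ Finset.Ioc 0 m, g j

/-- The unnormalized weight `λ^m / (c!(m) d!(κ - m))`. -/
noncomputable def weight {κ : ℕ} (c d : Fin (κ + 1) → ℝ) (lam : ℝ) (m : Fin (κ + 1)) : ℝ :=
  lam ^ (m : ℕ) / (rateFactorial c m * rateFactorial d (Fin.rev m))

/-- The normalization `Z_λ`. -/
noncomputable def partitionFn {κ : ℕ} (c d : Fin (κ + 1) → ℝ) (lam : ℝ) : ℝ :=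
  ∑ m, weight c d lam m

/-- The one-site marginal, of mass `weight m / Z_λ` at `m`. -/
noncomputable def marginal {κ : ℕ} (c d : Fin (κ + 1) → ℝ) (lam : ℝ) : Measure (Fin (κ + 1)) :=
  ∑ m, ENNReal.ofReal (weight c d lam m / partitionFn c d lam) • Measure.dirac m

/-- The homogeneous product measure with parameter `λ > 0`. -/
noncomputable def nuBar {κ : ℕ} (c d : Fin (κ + 1) → ℝ) (lam : ℝ) : Measure (Config κ) :=
  Measure.infinitePi fun _ : ℤ => marginal c d lam

/-- The density of particles at the origin under `nuBar c d lam`. -/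
noncomputable def density {κ : ℕ} (c d : Fin (κ + 1) → ℝ) (lam : ℝ) : ℝ :=
  ∫ η, ((η 0 : ℕ) : ℝ) ∂(nuBar c d lam)

/-- The inverse `λ(ρ)` of the bijection `density c d` from `(0, ∞)` to `(0, κ)`. -/
noncomputable def lambdaOf {κ : ℕ} (c d : Fin (κ + 1) → ℝ) (ρ : ℝ) : ℝ :=
  Function.invFunOn (density c d) (Set.Ioi 0) ρ

/-- The product measure `ν_ρ` of density `ρ`. -/
noncomputable def nu {κ : ℕ} (c d : Fin (κ + 1) → ℝ) (ρ : ℝ) : Measure (Config κ) :=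
  nuBar c d (lambdaOf c d ρ)

/-- The instantaneous current `W^S_{x,x+1}` of the symmetric part of the generator. -/
noncomputable def symCurrent {κ : ℕ} (r : Fin (κ + 1) → Fin (κ + 1) → ℝ) (x : ℤ)
    (η : Config κ) : ℝ :=
  (1 / 2) * (r (η x) (η (x + 1)) - r (η (x + 1)) (η x))

/-- The gradient condition holds with the function `h`. -/
def IsGradientWith {κ : ℕ} (r : Fin (κ + 1) → Fin (κ + 1) → ℝ) (h : Fin (κ + 1) → ℝ) : Prop :=
  ∀ (x : ℤ) (η : Config κ), symCurrent r x η = h (η x) - h (η (x + 1))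

/-- The process with jump rate `r` is of gradient type. -/
def IsGradient {κ : ℕ} (r : Fin (κ + 1) → Fin (κ + 1) → ℝ) : Prop :=
  ∃ h : Fin (κ + 1) → ℝ, IsGradientWith r h

/-- The jump rate is `r(a, b) = g(a) (g(κ) - g(b))` with `g ≥ 0`, `g(0) = 0`, `g(κ) > 0` and
`0 < g(m) < g(κ)` for `0 < m < κ`. -/
structure IsGradientRate {κ : ℕ} (r : Fin (κ + 1) → Fin (κ + 1) → ℝ)
    (g : Fin (κ + 1) → ℝ) : Prop where
  nonneg : ∀ m, 0 ≤ g m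
  zero : g 0 = 0
  last_pos : 0 < g (Fin.last κ)
  between : ∀ m, m ≠ 0 → m ≠ Fin.last κ → 0 < g m ∧ g m < g (Fin.last κ)
  rate : ∀ a b, r a b = g a * (g (Fin.last κ) - g b)

end PEP

namespace PEP

/-! The semigroup comes from finite boxes. The box generators `boxOp` are bounded, hence
exponentiate to Markov semigroups. On a function of the sites in `[-m, m]` they agree with `L_n`
once the box is large enough, and one application costs a factor `C * (m + 1)` and enlarges the
support by one site on each side. So the `k`-th iterate is at most `M * R ^ k * k!` in norm, and
Taylor's formula with a contraction remainder converges for small times. This yields convergence of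
the box semigroups (`exists_semigroup`), uniqueness (`semigroup_unique`), and invariance of every
measure that annihilates `L_n f` for local `f` (`invariant`). The semigroup property carries all
three to arbitrary times.

For invariance, the weights satisfy detailed balance, so the change of variables `η ↦ η^{x,y}` gives
`E[bondOp f] = n² (p - q) E[(r(η_{x+1}, η_x) - r(η_x, η_{x+1})) f]` (`expect_bondOp`). If the
current is a gradient, the sum over bonds telescopes to two sites outside the support of `f`. These
are independent of `f` and equally distributed, so the result is zero (`expect_boxOp_eq_zero`).
Conversely, for `f = 1{η_0 = a, η_1 = b}` only three bonds contribute. Since `p ≠ q`, the vanishing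
of their sum writes `r(b, a) - r(a, b)` as `φ(b) - φ(a)` (`exists_potential`); a single density
suffices.

The rest is algebra: a gradient current is additive along `m, 0, κ`, which forces condition 3; then
`g = c` gives condition 4; and `g(a)(g(κ) - g(b))` antisymmetrizes to `g(κ)(g(a) - g(b))`. -/

/-- Any `t` is a multiple of a short time `t / (k + 1)`. This passes from the interval of
convergence of the Taylor series to all times. -/
theorem forall_of_forall_lt_of_add {P : ℝ≥0 → Prop} {t₀ : ℝ≥0} (h₀ : 0 < t₀)
    (hlt : ∀ t < t₀, P t) (hadd : ∀ s t, P s → P t → P (s + t)) (t : ℝ≥0) : P t := by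
  have hmul : ∀ (k : ℕ) (s : ℝ≥0), P s → P ((k + 1 : ℕ) * s) := by
    intro k s hs
    induction k with
    | zero => simpa using hs
    | succ k ih =>
      have := hadd _ _ ih hs
      convert this using 1
      push_cast
      ring
  obtain ⟨k, hk⟩ := exists_nat_gt (t / t₀)
  have hk' : t / (k + 1 : ℕ) < t₀ := by
    rw [div_lt_iff₀ (by positivity)]
    rw [div_lt_iff₀ h₀] at hk
    refine hk.trans_le ?_
    rw [mul_comm]
    gcongr
    exact Nat.le_succ k
  have := hmul k _ (hlt _ hk')
  rwa [mul_div_cancel₀] at this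
  positivity

/-! ### Exponentials of bounded operators. -/

section Exponential

variable {E : Type*} [NormedAddCommGroup E] [NormedSpace ℝ E]

/-- The exponential `exp (t A)` of a bounded operator. -/
noncomputable def expOp (A : E →L[ℝ] E) (t : ℝ) : E →L[ℝ] E :=
  NormedSpace.exp (t • A)

theorem expOp_zero (A : E →L[ℝ] E) (f : E) : expOp A 0 f = f := by
  simp [expOp]

variable [CompleteSpace E]

theorem hasSum_expOp (A : E →L[ℝ] E) (t : ℝ) (f : E) :
    HasSum (fun n : ℕ => (t ^ n / n.factorial) • A^[n] f) (expOp A t f) := by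
  have h := (NormedSpace.exp_series_hasSum_exp' (𝕂 := ℝ) (t • A)).mapL
    (ContinuousLinearMap.apply ℝ E f)
  refine h.congr_fun ?_
  intro n
  simp [smul_pow, smul_smul, div_eq_inv_mul]

theorem expOp_add (A : E →L[ℝ] E) (s t : ℝ) (f : E) :
    expOp A (s + t) f = expOp A s (expOp A t f) := by
  let : NormedAlgebra ℚ (E →L[ℝ] E) := NormedAlgebra.restrictScalars ℚ ℝ _
  rw [expOp, add_smul,
    NormedSpace.exp_add_of_commute (((Commute.refl A).smul_left s).smul_right t)]
  rfl

theorem hasDerivAt_expOp (A : E →L[ℝ] E) (f : E) (t : ℝ) :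
    HasDerivAt (fun s => expOp A s f) (expOp A t (A f)) t := by
  have h := (ContinuousLinearMap.apply ℝ E f).hasFDerivAt.comp_hasDerivAt t
    (hasDerivAt_exp_smul_const (𝕂 := ℝ) A t)
  exact h

/-- Scalars commute with `A`. The shift by `K` turns a Markov generator into a positive operator,
whose exponential is visibly positive. -/
theorem expOp_eq_smul (A : E →L[ℝ] E) (K t : ℝ) (f : E) :
    expOp A t f = Real.exp (-(t * K)) • expOp (A + K • ContinuousLinearMap.id ℝ E) t f := by
  let : NormedAlgebra ℚ (E →L[ℝ] E) := NormedAlgebra.restrictScalars ℚ ℝ _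
  have e : t • A = algebraMap ℝ (E →L[ℝ] E) (-(t * K)) +
      t • (A + K • ContinuousLinearMap.id ℝ E) := by
    ext g
    simp [Algebra.algebraMap_eq_smul_one]
    module
  rw [expOp, e, NormedSpace.exp_add_of_commute (Algebra.commutes _ _),
    ← NormedSpace.algebraMap_exp_comm, ← Real.exp_eq_exp_ℝ, ← Algebra.smul_def]
  rfl

end Exponential

/-! ### Bounded Markov generators. -/

section Generator

variable {X : Type*} [TopologicalSpace X]

/-- The generators of the form `A = B - K` with `B` positive and `A 1 = 0`. -/
structure IsMarkovGenerator (A : C(X, ℝ) →L[ℝ] C(X, ℝ)) : Prop where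
  one : A 1 = 0
  nonneg : ∃ K : ℝ, ∀ f, 0 ≤ f → 0 ≤ A f + K • f

theorem IsMarkovGenerator.zero : IsMarkovGenerator (0 : C(X, ℝ) →L[ℝ] C(X, ℝ)) :=
  ⟨rfl, 0, fun f _ => by simp⟩

theorem IsMarkovGenerator.add {A B : C(X, ℝ) →L[ℝ] C(X, ℝ)} (hA : IsMarkovGenerator A)
    (hB : IsMarkovGenerator B) : IsMarkovGenerator (A + B) := by
  obtain ⟨K, hK⟩ := hA.nonneg
  obtain ⟨K', hK'⟩ := hB.nonneg
  refine ⟨by simp [hA.one, hB.one], K + K', fun f hf => ?_⟩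
  have := add_nonneg (hK f hf) (hK' f hf)
  convert this using 1
  rw [add_smul, add_apply]
  abel

theorem IsMarkovGenerator.smul {A : C(X, ℝ) →L[ℝ] C(X, ℝ)} (hA : IsMarkovGenerator A)
    {a : ℝ} (ha : 0 ≤ a) : IsMarkovGenerator (a • A) := by
  obtain ⟨K, hK⟩ := hA.nonneg
  refine ⟨by simp [hA.one], a * K, fun f hf => ?_⟩
  have := smul_nonneg ha (hK f hf)
  convert this using 1
  rw [smul_add, smul_smul, smul_apply]

theorem IsMarkovGenerator.sum {ι : Type*} (s : Finset ι) {A : ι → C(X, ℝ) →L[ℝ] C(X, ℝ)}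
    (hA : ∀ i ∈ s, IsMarkovGenerator (A i)) : IsMarkovGenerator (∑ i ∈ s, A i) :=
  Finset.sum_induction _ _ (fun _ _ => .add) .zero hA

end Generator

/-! ### Markov semigroups and Taylor's formula. -/

section Semigroup

variable {X : Type*} [TopologicalSpace X] [CompactSpace X]

theorem norm_apply_le_of_nonneg_of_one {P : C(X, ℝ) →ₗ[ℝ] C(X, ℝ)}
    (hpos : ∀ f, 0 ≤ f → 0 ≤ P f) (hone : P 1 = 1) (f : C(X, ℝ)) : ‖P f‖ ≤ ‖f‖ := by
  rw [ContinuousMap.norm_le _ (norm_nonneg _)]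
  intro x
  have hb : ∀ y, |f y| ≤ ‖f‖ := fun y => f.norm_coe_le_norm y
  have h1 : 0 ≤ P (‖f‖ • 1 - f) := hpos _ fun y => by
    simpa using (le_abs_self _).trans (hb y)
  have h2 : 0 ≤ P (‖f‖ • 1 + f) := hpos _ fun y => by
    have := (neg_le_abs (f y)).trans (hb y)
    change 0 ≤ ‖f‖ * 1 + f y
    linarith
  have h1x := h1 x
  have h2x := h2 x
  rw [map_sub, map_smul, hone] at h1x
  rw [map_add, map_smul, hone] at h2x
  simp at h1x h2x
  rw [Real.norm_eq_abs, abs_le]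
  constructor <;> linarith

namespace IsMarkovSemigroup

variable {S : ℝ≥0 → C(X, ℝ) →ₗ[ℝ] C(X, ℝ)}

theorem norm_le (hS : IsMarkovSemigroup S) (t : ℝ≥0) (f : C(X, ℝ)) : ‖S t f‖ ≤ ‖f‖ :=
  norm_apply_le_of_nonneg_of_one (hS.nonneg t) (hS.one t) f

theorem continuous_apply (hS : IsMarkovSemigroup S) (t : ℝ≥0) : Continuous (S t) :=
  AddMonoidHomClass.continuous_of_bound (S t) 1 fun f => by simpa using hS.norm_le t f

/-- For `s > t` the increment is `S t` applied to `S (s - t) f - f`, and `S t` is continuous. A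
right derivative is all that the mean value inequality below needs. -/
theorem hasDerivWithinAt (hS : IsMarkovSemigroup S) {f g : C(X, ℝ)} (h : HasGenerator S f g)
    {t : ℝ} (ht : 0 ≤ t) :
    HasDerivWithinAt (fun s : ℝ => S s.toNNReal f) (S t.toNNReal g) (Set.Ici t) t := by
  rw [← hasDerivWithinAt_Ioi_iff_Ici, hasDerivWithinAt_iff_tendsto_slope' (by simp)]
  have hs : Tendsto (fun s : ℝ => (s - t).toNNReal) (𝓝[>] t) (𝓝[>] 0) := by
    refine tendsto_nhdsWithin_iff.2 ⟨?_, ?_⟩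
    · have : Tendsto (fun s : ℝ => (s - t).toNNReal) (𝓝 t) (𝓝 (t - t).toNNReal) :=
        (continuous_real_toNNReal.comp (continuous_id.sub continuous_const)).tendsto t
      simp only [sub_self, Real.toNNReal_zero] at this
      exact this.mono_left nhdsWithin_le_nhds
    · filter_upwards [self_mem_nhdsWithin] with s hs
      simpa using hs
  refine (((hS.continuous_apply t.toNNReal).tendsto g).comp (h.comp hs)).congr' ?_
  filter_upwards [self_mem_nhdsWithin] with s hs
  have hs' : t < s := hs
  have e : s.toNNReal = t.toNNReal + (s - t).toNNReal := by
    rw [← Real.toNNReal_add ht (by linarith)]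
    simp
  simp only [Function.comp_apply, slope_def_module, map_smul, map_sub]
  rw [Real.coe_toNNReal _ (by linarith : (0 : ℝ) ≤ s - t), e, hS.add]
  simp

/-- Taylor's formula with remainder along a sequence of iterated generators. -/
theorem norm_sub_taylor_le (hS : IsMarkovSemigroup S) (K : ℕ) {u : ℕ → C(X, ℝ)}
    (hu : ∀ k < K, HasGenerator S (u k) (u (k + 1))) (t : ℝ≥0) :
    ‖S t (u 0) - ∑ k ∈ Finset.range K, ((t : ℝ) ^ k / k.factorial) • u k‖ ≤
      (t : ℝ) ^ K / K.factorial * ‖u K‖ := by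
  induction K generalizing u t with
  | zero => simpa using hS.norm_le t (u 0)
  | succ K ih =>
    have hder : ∀ (k : ℕ) (x : ℝ), HasDerivAt (fun s : ℝ => s ^ (k + 1) / (k + 1).factorial)
        (x ^ k / k.factorial) x := by
      intro k x
      have := (hasDerivAt_pow (k + 1) x).div_const ((k + 1).factorial : ℝ)
      have e : x ^ k / (k.factorial : ℝ) =
          ((k + 1 : ℕ) : ℝ) * x ^ (k + 1 - 1) / ((k + 1).factorial : ℝ) := by
        rw [Nat.factorial_succ]
        push_cast
        field_simp
      rw [e]
      exact this
    -- The right derivative of the remainder of order `K + 1` is the remainder of order `K` of the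
    -- shifted sequence `u (k + 1)`. The induction hypothesis bounds it by the derivative of the
    -- claimed bound.
    have key := image_norm_le_of_norm_deriv_right_le_deriv_boundary
      (f := fun s : ℝ => S s.toNNReal (u 0) -
        ∑ k ∈ Finset.range (K + 1), (s ^ k / (k.factorial : ℝ)) • u k)
      (f' := fun s : ℝ => S s.toNNReal (u 1) -
        ∑ k ∈ Finset.range K, (s ^ k / (k.factorial : ℝ)) • u (k + 1))
      (a := 0) (b := t)
      (B := fun s => s ^ (K + 1) / (K + 1).factorial * ‖u (K + 1)‖)
      (B' := fun s => s ^ K / K.factorial * ‖u (K + 1)‖) ?_ ?_ ?_ ?_ ?_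
      (x := t) ⟨t.2, le_rfl⟩
    · simpa using key
    · refine Continuous.continuousOn (Continuous.sub ?_ ?_)
      · exact (hS.continuous _).comp continuous_real_toNNReal
      · fun_prop
    · intro x hx
      refine (hS.hasDerivWithinAt (hu 0 (by omega)) hx.1).sub ?_
      simp_rw [Finset.sum_range_succ']
      have h1 : HasDerivAt (fun s : ℝ => ∑ k ∈ Finset.range K,
          (s ^ (k + 1) / ((k + 1).factorial : ℝ)) • u (k + 1))
          (∑ k ∈ Finset.range K, (x ^ k / (k.factorial : ℝ)) • u (k + 1)) x :=
        HasDerivAt.fun_sum fun k _ =>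
          HasDerivAt.smul_const (F := C(X, ℝ)) (hder k x) (u (k + 1))
      simpa using (h1.add_const (u 0)).hasDerivWithinAt
    · simp [Finset.sum_range_succ', hS.zero]
    · intro x
      exact (hder K x).mul_const _
    · intro x hx
      have := ih (u := fun k => u (k + 1)) (fun k hk => hu (k + 1) (by omega)) x.toNNReal
      simpa [Real.coe_toNNReal _ hx.1] using this

theorem tendsto_taylor_sum (hS : IsMarkovSemigroup S) {u : ℕ → C(X, ℝ)}
    (hu : ∀ k, HasGenerator S (u k) (u (k + 1))) {M R : ℝ}
    (hR : ∀ k, ‖u k‖ ≤ M * R ^ k * k.factorial) {t : ℝ≥0} (hRt : 0 ≤ R) (ht : t * R < 1) :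
    Tendsto (fun K => ∑ k ∈ Finset.range K, ((t : ℝ) ^ k / k.factorial) • u k) atTop
      (𝓝 (S t (u 0))) := by
  rw [tendsto_iff_norm_sub_tendsto_zero]
  have h0 : Tendsto (fun K : ℕ => M * (t * R) ^ K) atTop (𝓝 0) := by
    simpa using (tendsto_pow_atTop_nhds_zero_of_lt_one (by positivity) ht).const_mul M
  refine squeeze_zero (fun _ => norm_nonneg _) (fun K => ?_) h0
  rw [norm_sub_rev]
  refine (hS.norm_sub_taylor_le K (fun k _ => hu k) t).trans ?_
  calc (t : ℝ) ^ K / K.factorial * ‖u K‖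
      ≤ (t : ℝ) ^ K / K.factorial * (M * R ^ K * K.factorial) := by gcongr; exact hR K
    _ = M * (t * R) ^ K := by
      field_simp
      ring

end IsMarkovSemigroup

theorem expOp_nonneg {B : C(X, ℝ) →L[ℝ] C(X, ℝ)} (hB : ∀ f, 0 ≤ f → 0 ≤ B f) {t : ℝ}
    (ht : 0 ≤ t) {f : C(X, ℝ)} (hf : 0 ≤ f) : 0 ≤ expOp B t f := by
  intro x
  have h1 := (hasSum_expOp B t f).mapL (ContinuousMap.evalCLM ℝ x)
  refine h1.nonneg fun n => ?_
  have hn : 0 ≤ B^[n] f := by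
    induction n with
    | zero => simpa using hf
    | succ n ih => rw [Function.iterate_succ_apply']; exact hB _ ih
  have := hn x
  change 0 ≤ t ^ n / n.factorial * (B^[n] f) x
  exact mul_nonneg (by positivity) this

/-- The semigroup `exp (t A)` generated by a bounded operator. -/
noncomputable def expSemigroup (A : C(X, ℝ) →L[ℝ] C(X, ℝ)) (t : ℝ≥0) :
    C(X, ℝ) →ₗ[ℝ] C(X, ℝ) :=
  (expOp A t).toLinearMap

theorem hasGenerator_expSemigroup (A : C(X, ℝ) →L[ℝ] C(X, ℝ)) (f : C(X, ℝ)) :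
    HasGenerator (expSemigroup A) f (A f) := by
  have h1 := (hasDerivAt_expOp A f 0).hasDerivWithinAt (s := Set.Ioi 0)
  rw [hasDerivWithinAt_iff_tendsto_slope' (by simp)] at h1
  have hc : Tendsto (fun t : ℝ≥0 => (t : ℝ)) (𝓝[>] 0) (𝓝[>] 0) := by
    refine tendsto_nhdsWithin_iff.2 ⟨?_, ?_⟩
    · exact (NNReal.continuous_coe.tendsto 0).mono_left nhdsWithin_le_nhds
    · filter_upwards [self_mem_nhdsWithin] with s hs
      simpa using hs
  have h2 := h1.comp hc
  rw [expOp_zero] at h2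
  refine h2.congr fun t => ?_
  simp [slope_def_module, expSemigroup, expOp_zero]

theorem IsMarkovGenerator.isMarkovSemigroup {A : C(X, ℝ) →L[ℝ] C(X, ℝ)}
    (hA : IsMarkovGenerator A) : IsMarkovSemigroup (expSemigroup A) where
  zero := LinearMap.ext fun f => expOp_zero A f
  add s t := LinearMap.ext fun f => expOp_add A s t f
  one t := by
    -- As `A 1 = 0`, only the term of order `0` of the exponential series survives.
    have h := hasSum_single (f := fun n : ℕ => ((t : ℝ) ^ n / n.factorial) • A^[n] 1) 0
      fun n hn => by
        obtain ⟨k, rfl⟩ := Nat.exists_eq_succ_of_ne_zero hn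
        rw [Function.iterate_succ_apply, hA.one, iterate_map_zero, smul_zero]
    refine ((hasSum_expOp A t 1).unique h).trans ?_
    simp
  nonneg t f hf := by
    obtain ⟨K, hK⟩ := hA.nonneg
    change 0 ≤ expOp A t f
    rw [expOp_eq_smul A K]
    exact smul_nonneg (Real.exp_nonneg _) (expOp_nonneg (fun f hf => hK f hf) t.2 hf)
  continuous f := by
    have h : Continuous fun u : ℝ => expOp A u f :=
      continuous_iff_continuousAt.2 fun u => (hasDerivAt_expOp A f u).continuousAt
    exact h.comp NNReal.continuous_coe

end Semigroup

/-! ### Construction and uniqueness of the semigroup from local approximations. -/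

section Approximation

variable {X : Type*} [TopologicalSpace X] [CompactSpace X]

/-- Bounded Markov generators `T N` that stabilize on an increasing filtration `D` of a dense
set of functions and whose norm on `D m` grows at most linearly in `m`. -/
structure IsLocalApproximation (D : ℕ → Set C(X, ℝ)) (T : ℕ → C(X, ℝ) →L[ℝ] C(X, ℝ))
    (C : ℝ≥0) : Prop where
  dense : Dense (⋃ m, D m)
  generator : ∀ N, IsMarkovGenerator (T N)
  mem : ∀ {m f} N, f ∈ D m → T N f ∈ D (m + 1)
  stable : ∀ {m f N}, f ∈ D m → m + 1 ≤ N → T N f = T (m + 1) f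
  bound : ∀ {m f} N, f ∈ D m → ‖T N f‖ ≤ C * (m + 1) * ‖f‖

namespace IsLocalApproximation

variable {D : ℕ → Set C(X, ℝ)} {T : ℕ → C(X, ℝ) →L[ℝ] C(X, ℝ)} {C : ℝ≥0}

theorem iterate_mem (h : IsLocalApproximation D T C) {m : ℕ} {f : C(X, ℝ)} (hf : f ∈ D m)
    (N k : ℕ) : (T N)^[k] f ∈ D (m + k) := by
  induction k with
  | zero => exact hf
  | succ k ih => rw [Function.iterate_succ_apply']; exact h.mem N ih

/-- The last of the `k` applications acts on an element of `D (m + k - 1)`, where stability begins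
at index `m + k`. -/
theorem iterate_stable (h : IsLocalApproximation D T C) {m : ℕ} {f : C(X, ℝ)} (hf : f ∈ D m)
    {N k : ℕ} (hN : m + k ≤ N) : (T N)^[k] f = (T (m + k))^[k] f := by
  induction k generalizing N with
  | zero => rfl
  | succ k ih =>
    rw [Function.iterate_succ_apply', Function.iterate_succ_apply', ih (by omega),
      ih (N := m + (k + 1)) (by omega)]
    exact h.stable (h.iterate_mem hf _ k) hN

/-- The successive factors `C (m + 1), …, C (m + k)` multiply to `C ^ k * k! * choose (m + k) k`,
and the binomial coefficient is at most `2 ^ (m + k)`. -/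
theorem norm_iterate_le (h : IsLocalApproximation D T C) {m : ℕ} {f : C(X, ℝ)} (hf : f ∈ D m)
    (N k : ℕ) : ‖(T N)^[k] f‖ ≤ 2 ^ m * ‖f‖ * (2 * C) ^ k * k.factorial := by
  have h1 : ‖(T N)^[k] f‖ ≤ C ^ k * (m + 1).ascFactorial k * ‖f‖ := by
    induction k with
    | zero => simp
    | succ k ih =>
      rw [Function.iterate_succ_apply']
      refine (h.bound N (h.iterate_mem hf N k)).trans ?_
      rw [Nat.ascFactorial_succ]
      calc (C : ℝ) * ((m + k : ℕ) + 1) * ‖(T N)^[k] f‖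
          ≤ C * ((m + k : ℕ) + 1) * (C ^ k * (m + 1).ascFactorial k * ‖f‖) := by gcongr
        _ = _ := by push_cast; ring
  have h2 : ((m + 1).ascFactorial k : ℝ) ≤ k.factorial * 2 ^ (m + k) := by
    rw [Nat.ascFactorial_eq_factorial_mul_choose]
    exact_mod_cast Nat.mul_le_mul_left _ (Nat.choose_le_two_pow _ _)
  refine h1.trans ?_
  calc (C : ℝ) ^ k * (m + 1).ascFactorial k * ‖f‖
      ≤ C ^ k * (k.factorial * 2 ^ (m + k)) * ‖f‖ := by gcongr
    _ = _ := by rw [pow_add, mul_pow]; ring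

/-- The semigroup `S` is generated by the limit of the operators `T N`. -/
def Generates (D : ℕ → Set C(X, ℝ)) (T : ℕ → C(X, ℝ) →L[ℝ] C(X, ℝ))
    (S : ℝ≥0 → C(X, ℝ) →ₗ[ℝ] C(X, ℝ)) : Prop :=
  ∀ m, ∀ f ∈ D m, HasGenerator S f (T (m + 1) f)

/-- The `+ 1` covers `C = 0`, where `1 / (2 * C)` would be `0`. -/
theorem radius_pos (C : ℝ≥0) : 0 < 1 / (2 * C + 1) := by positivity

theorem mul_lt_one_of_lt_radius {C t : ℝ≥0} (ht : t < 1 / (2 * C + 1)) :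
    (t : ℝ) * (2 * C) < 1 := by
  have h : t * (2 * C + 1) < 1 := by rwa [lt_div_iff₀ (by positivity)] at ht
  have h' : (t : ℝ) * (2 * C + 1) < 1 := by exact_mod_cast h
  nlinarith [t.2]

/-- By stability the generator of `S` maps `(T (m + k))^[k] f` to the next term of the same form.
For short times `S t f` is thus determined by `T` alone. -/
theorem tendsto_taylor (h : IsLocalApproximation D T C) {S : ℝ≥0 → C(X, ℝ) →ₗ[ℝ] C(X, ℝ)}
    (hS : IsMarkovSemigroup S) (hST : Generates D T S) {m : ℕ} {f : C(X, ℝ)} (hf : f ∈ D m)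
    {t : ℝ≥0} (ht : t < 1 / (2 * C + 1)) :
    Tendsto (fun K => ∑ k ∈ Finset.range K, ((t : ℝ) ^ k / k.factorial) • (T (m + k))^[k] f)
      atTop (𝓝 (S t f)) := by
  refine hS.tendsto_taylor_sum (u := fun k => (T (m + k))^[k] f) (fun k => ?_)
    (fun k => h.norm_iterate_le hf _ k) (by positivity) (mul_lt_one_of_lt_radius ht)
  have := hST (m + k) _ (h.iterate_mem hf (m + k) k)
  rw [← h.iterate_stable hf (N := m + k + 1) (by omega)] at this ⊢
  rwa [← Function.iterate_succ_apply' (T (m + k + 1))] at this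

theorem semigroup_unique (h : IsLocalApproximation D T C)
    {S S' : ℝ≥0 → C(X, ℝ) →ₗ[ℝ] C(X, ℝ)} (hS : IsMarkovSemigroup S) (hST : Generates D T S)
    (hS' : IsMarkovSemigroup S') (hST' : Generates D T S') : S = S' := by
  funext t
  refine forall_of_forall_lt_of_add (P := fun t => S t = S' t) (radius_pos C)
    (fun t ht => ?_) (fun s t hs ht => by rw [hS.add, hS'.add, hs, ht]) t
  refine LinearMap.ext fun f => ?_
  refine congrFun ((hS.continuous_apply t).ext_on h.dense (hS'.continuous_apply t) ?_) f
  rintro f hf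
  obtain ⟨m, hm⟩ := Set.mem_iUnion.1 hf
  exact tendsto_nhds_unique (h.tendsto_taylor hS hST hm ht) (h.tendsto_taylor hS' hST' hm ht)

/-- In the Taylor series of `S t f`, every term of positive order is the generator applied to a
function in some `D`, so `I` kills it and only `I f` remains. -/
theorem invariant (h : IsLocalApproximation D T C) {S : ℝ≥0 → C(X, ℝ) →ₗ[ℝ] C(X, ℝ)}
    (hS : IsMarkovSemigroup S) (hST : Generates D T S) (I : C(X, ℝ) →L[ℝ] ℝ)
    (hI : ∀ m, ∀ f ∈ D m, I (T (m + 1) f) = 0) (t : ℝ≥0) (f : C(X, ℝ)) : I (S t f) = I f := by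
  refine forall_of_forall_lt_of_add (P := fun t => ∀ f, I (S t f) = I f) (radius_pos C)
    (fun t ht f => ?_) (fun s t hs ht f => ?_) t f
  · refine congrFun ((I.continuous.comp (hS.continuous_apply t)).ext_on h.dense I.continuous ?_) f
    intro f hf
    obtain ⟨m, hm⟩ := Set.mem_iUnion.1 hf
    refine tendsto_nhds_unique ((I.continuous.tendsto _).comp (h.tendsto_taylor hS hST hm ht))
      (tendsto_const_nhds.congr' ?_)
    -- The empty sum, `K = 0`, lacks the term `f`.
    filter_upwards [eventually_ge_atTop 1] with K hK
    obtain ⟨K, rfl⟩ := Nat.exists_eq_succ_of_ne_zero (Nat.one_le_iff_ne_zero.1 hK)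
    simp only [Function.comp_apply, map_sum]
    rw [Finset.sum_range_succ', Finset.sum_eq_zero]
    · simp
    · intro k _
      rw [map_smul, Function.iterate_succ_apply']
      have := hI (m + k) _ (h.iterate_mem hm (m + (k + 1)) k)
      rw [← add_assoc m k 1] at this ⊢
      rw [this, smul_zero]
  · rw [hS.add, LinearMap.comp_apply, hs, ht]

theorem cauchySeq_of_dense {P : ℕ → C(X, ℝ) →ₗ[ℝ] C(X, ℝ)} (hP : ∀ N f, ‖P N f‖ ≤ ‖f‖)
    {s : Set C(X, ℝ)} (hs : Dense s) (hc : ∀ f ∈ s, CauchySeq fun N => P N f) (f : C(X, ℝ)) :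
    CauchySeq fun N => P N f := by
  rw [Metric.cauchySeq_iff]
  intro ε hε
  obtain ⟨g, hg, hfg⟩ := Metric.dense_iff.1 hs f (ε / 3) (by positivity)
  obtain ⟨N₀, hN₀⟩ := Metric.cauchySeq_iff.1 (hc g hfg) (ε / 3) (by positivity)
  refine ⟨N₀, fun M hM N hN => ?_⟩
  have hd : ∀ N, dist (P N f) (P N g) < ε / 3 := by
    intro N
    rw [dist_eq_norm, ← map_sub]
    refine (hP N _).trans_lt ?_
    rwa [← dist_eq_norm, dist_comm]
  have h1 := dist_triangle4 (P M f) (P M g) (P N g) (P N f)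
  have h2 := hd M
  have h3 := hd N
  have h4 := hN₀ M hM N hN
  rw [dist_comm] at h3
  linarith

/-- For `N ≥ m + K` the Taylor polynomial with `K` terms does not depend on `N`, and its remainder
is small uniformly in `N`. -/
theorem cauchySeq_expSemigroup_of_lt (h : IsLocalApproximation D T C) {m : ℕ} {f : C(X, ℝ)}
    (hf : f ∈ D m) {t : ℝ≥0} (ht : t < 1 / (2 * C + 1)) :
    CauchySeq fun N => expSemigroup (T N) t f := by
  rw [Metric.cauchySeq_iff]
  intro ε hε
  have ht' := mul_lt_one_of_lt_radius ht
  have h0 : Tendsto (fun K : ℕ => 2 ^ m * ‖f‖ * (t * (2 * C) : ℝ) ^ K) atTop (𝓝 0) := by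
    simpa using (tendsto_pow_atTop_nhds_zero_of_lt_one (by positivity) ht').const_mul (2 ^ m * ‖f‖)
  obtain ⟨K, hK⟩ := (h0.eventually_lt_const (half_pos hε)).exists
  have key : ∀ N ≥ m + K, dist (expSemigroup (T N) t f)
      (∑ k ∈ Finset.range K, ((t : ℝ) ^ k / k.factorial) • (T (m + k))^[k] f) < ε / 2 := by
    intro N hN
    have := (h.generator N).isMarkovSemigroup.norm_sub_taylor_le K (u := fun k => (T N)^[k] f)
      (fun k _ => by
        rw [Function.iterate_succ_apply']
        exact hasGenerator_expSemigroup _ _) t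
    rw [dist_eq_norm]
    rw [Finset.sum_congr rfl fun k hk => by
      rw [← h.iterate_stable hf (N := N) (by have := Finset.mem_range.1 hk; omega)]]
    refine (this.trans ?_).trans_lt hK
    calc (t : ℝ) ^ K / K.factorial * ‖(T N)^[K] f‖
        ≤ (t : ℝ) ^ K / K.factorial * (2 ^ m * ‖f‖ * (2 * C) ^ K * K.factorial) := by
          gcongr
          exact h.norm_iterate_le hf N K
      _ = _ := by
        rw [mul_pow, mul_pow, mul_pow]
        field_simp
  refine ⟨m + K, fun M hM N hN => ?_⟩
  have h1 := key M hM
  have h2 := key N hN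
  have h3 := dist_triangle_right (expSemigroup (T M) t f) (expSemigroup (T N) t f)
    (∑ k ∈ Finset.range K, ((t : ℝ) ^ k / k.factorial) • (T (m + k))^[k] f)
  linarith

theorem tendsto_comp_of_norm_le {P Q : ℕ → C(X, ℝ) →ₗ[ℝ] C(X, ℝ)}
    (hP : ∀ N f, ‖P N f‖ ≤ ‖f‖) {f g g' : C(X, ℝ)}
    (hQ : Tendsto (fun N => Q N f) atTop (𝓝 g)) (hg : Tendsto (fun N => P N g) atTop (𝓝 g')) :
    Tendsto (fun N => P N (Q N f)) atTop (𝓝 g') := by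
  have h1 : Tendsto (fun N => P N (Q N f - g)) atTop (𝓝 0) :=
    squeeze_zero_norm (fun N => hP N _) (tendsto_iff_norm_sub_tendsto_zero.1 hQ)
  simpa using h1.add hg

theorem cauchySeq_expSemigroup (h : IsLocalApproximation D T C) (t : ℝ≥0) (f : C(X, ℝ)) :
    CauchySeq fun N => expSemigroup (T N) t f := by
  refine forall_of_forall_lt_of_add
    (P := fun t => ∀ f, CauchySeq fun N => expSemigroup (T N) t f) (radius_pos C)
    (fun t ht f => ?_) (fun s t hs ht f => ?_) t f
  · refine cauchySeq_of_dense (fun N => (h.generator N).isMarkovSemigroup.norm_le t) h.dense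
      (fun f hf => ?_) f
    obtain ⟨m, hm⟩ := Set.mem_iUnion.1 hf
    exact h.cauchySeq_expSemigroup_of_lt hm ht
  · obtain ⟨g, hg⟩ := cauchySeq_tendsto_of_complete (ht f)
    obtain ⟨g', hg'⟩ := cauchySeq_tendsto_of_complete (hs g)
    have := tendsto_comp_of_norm_le (fun N => (h.generator N).isMarkovSemigroup.norm_le s) hg hg'
    refine Tendsto.cauchySeq (x := g') (this.congr fun N => ?_)
    rw [(h.generator N).isMarkovSemigroup.add, LinearMap.comp_apply]

theorem exists_semigroup (h : IsLocalApproximation D T C) :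
    ∃ S : ℝ≥0 → C(X, ℝ) →ₗ[ℝ] C(X, ℝ), IsMarkovSemigroup S ∧ Generates D T S := by
  choose S hS using fun t f => cauchySeq_tendsto_of_complete (h.cauchySeq_expSemigroup t f)
  have hM := fun N => (h.generator N).isMarkovSemigroup
  let S' : ℝ≥0 → C(X, ℝ) →ₗ[ℝ] C(X, ℝ) := fun t =>
    { toFun := S t
      map_add' := fun f g => tendsto_nhds_unique (hS t (f + g)) <| by
        simpa using (hS t f).add (hS t g)
      map_smul' := fun a f => tendsto_nhds_unique (hS t (a • f)) <| by
        simpa using (hS t f).const_smul a }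
  have hS' : ∀ t f, Tendsto (fun N => expSemigroup (T N) t f) atTop (𝓝 (S' t f)) := hS
  clear_value S'
  have hadd : ∀ s t, S' (s + t) = S' s ∘ₗ S' t := by
    refine fun s t => LinearMap.ext fun f => tendsto_nhds_unique (hS' (s + t) f) ?_
    refine (tendsto_comp_of_norm_le (fun N => (hM N).norm_le s) (hS' t f) (hS' s _)).congr
      fun N => ?_
    rw [(hM N).add, LinearMap.comp_apply]
  have hone : ∀ t, S' t 1 = 1 := fun t => tendsto_nhds_unique (hS' t 1) <|
    tendsto_const_nhds.congr fun N => ((hM N).one t).symm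
  have hpos : ∀ t f, 0 ≤ f → 0 ≤ S' t f := by
    intro t f hf x
    have hx := ((ContinuousMap.evalCLM ℝ x).continuous.tendsto (S' t f)).comp (hS' t f)
    exact ge_of_tendsto' hx fun N => (hM N).nonneg t f hf x
  have hzero : S' 0 = LinearMap.id :=
    LinearMap.ext fun f => tendsto_nhds_unique (hS' 0 f) <|
      tendsto_const_nhds.congr fun N => by rw [(hM N).zero, LinearMap.id_apply]
  have hnorm : ∀ t f, ‖S' t f‖ ≤ ‖f‖ := fun t =>
    norm_apply_le_of_nonneg_of_one (hpos t) (hone t)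
  -- The Taylor estimate survives the limit `N → ∞`. Below, `K = 1` gives continuity at time `0` and
  -- `K = 2` gives the generator.
  have htaylor : ∀ m, ∀ f ∈ D m, ∀ K t,
      ‖S' t f - ∑ k ∈ Finset.range K, ((t : ℝ) ^ k / k.factorial) • (T (m + k))^[k] f‖ ≤
        (t : ℝ) ^ K / K.factorial * ‖(T (m + K))^[K] f‖ := by
    intro m f hf K t
    refine le_of_tendsto ((hS' t f).sub_const _).norm ?_
    filter_upwards [eventually_ge_atTop (m + K)] with N hN
    have := (hM N).norm_sub_taylor_le K (u := fun k => (T N)^[k] f)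
      (fun k _ => by
        rw [Function.iterate_succ_apply']
        exact hasGenerator_expSemigroup _ _) t
    rw [Finset.sum_congr rfl fun k hk => by
      rw [← h.iterate_stable hf (N := N) (by have := Finset.mem_range.1 hk; omega)],
      ← h.iterate_stable hf hN]
    exact this
  have hcont : ∀ f, Tendsto (fun t => S' t f) (𝓝 0) (𝓝 f) := by
    intro f
    rw [Metric.tendsto_nhds]
    intro ε hε
    obtain ⟨g, hg, hfg⟩ := Metric.dense_iff.1 h.dense f (ε / 3) (by positivity)
    obtain ⟨m, hm⟩ := Set.mem_iUnion.1 hfg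
    have h0 : Tendsto (fun t : ℝ≥0 => (t : ℝ) * ‖T (m + 1) g‖) (𝓝 0) (𝓝 0) := by
      have : Continuous fun t : ℝ≥0 => (t : ℝ) * ‖T (m + 1) g‖ := by fun_prop
      simpa using this.tendsto 0
    filter_upwards [h0.eventually_lt_const (show 0 < ε / 3 by positivity)] with t ht
    have h1 : dist (S' t f) (S' t g) < ε / 3 := by
      rw [dist_eq_norm, ← map_sub]
      refine (hnorm t _).trans_lt ?_
      rwa [← dist_eq_norm, dist_comm]
    have h2 : dist (S' t g) g < ε / 3 := by
      have := htaylor m g hm 1 t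
      simp at this
      rw [dist_eq_norm]
      exact this.trans_lt ht
    have h3 := dist_triangle4 (S' t f) (S' t g) g f
    have h4 : dist g f < ε / 3 := hg
    linarith
  refine ⟨S', ⟨hzero, hadd, hone, hpos, fun f => ?_⟩, fun m f hf => ?_⟩
  · refine continuous_iff_continuousAt.2 fun t => ?_
    rw [ContinuousAt, tendsto_iff_norm_sub_tendsto_zero]
    -- One of the two truncated differences is zero, so their sum is `|s - t|`; contractivity
    -- reduces continuity at `t` to continuity at `0`.
    have hbd : ∀ s, ‖S' s f - S' t f‖ ≤ ‖S' ((s - t) + (t - s)) f - f‖ := by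
      intro s
      rcases le_total s t with hst | hst
      · rw [tsub_eq_zero_of_le hst, zero_add, norm_sub_rev]
        nth_rw 1 [← add_tsub_cancel_of_le hst]
        rw [hadd, LinearMap.comp_apply, ← map_sub]
        exact hnorm _ _
      · rw [tsub_eq_zero_of_le hst, add_zero]
        nth_rw 1 [← add_tsub_cancel_of_le hst]
        rw [hadd, LinearMap.comp_apply, ← map_sub]
        exact hnorm _ _
    refine squeeze_zero (fun _ => norm_nonneg _) hbd ?_
    have h0 : Tendsto (fun s => (s - t) + (t - s)) (𝓝 t) (𝓝 0) := by
      have : Continuous fun s : ℝ≥0 => (s - t) + (t - s) := by fun_prop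
      simpa using this.tendsto t
    exact tendsto_iff_norm_sub_tendsto_zero.1 ((hcont f).comp h0)
  · rw [HasGenerator, tendsto_iff_norm_sub_tendsto_zero]
    have h0 : Tendsto (fun t : ℝ≥0 => (t : ℝ) / 2 * ‖(T (m + 2))^[2] f‖) (𝓝[>] 0) (𝓝 0) := by
      have : Continuous fun t : ℝ≥0 => (t : ℝ) / 2 * ‖(T (m + 2))^[2] f‖ := by fun_prop
      have := this.tendsto 0
      simp only [NNReal.coe_zero, zero_div, zero_mul] at this
      exact this.mono_left nhdsWithin_le_nhds
    refine squeeze_zero' (Eventually.of_forall fun _ => norm_nonneg _) ?_ h0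
    filter_upwards [self_mem_nhdsWithin] with t ht
    have ht0 : (0 : ℝ) < t := ht
    have h2 := htaylor m f hf 2 t
    simp only [Finset.sum_range_succ, Finset.sum_range_zero, zero_add, pow_zero, pow_one,
      Nat.factorial_zero, Nat.factorial_one, Nat.factorial_two, Nat.cast_one, div_one, one_smul,
      Function.iterate_zero, id, Function.iterate_one] at h2
    have e : (t : ℝ)⁻¹ • (S' t f - f) - T (m + 1) f =
        (t : ℝ)⁻¹ • (S' t f - (f + (t : ℝ) • T (m + 1) f)) := by
      rw [← sub_sub, smul_sub _ (S' t f - f), smul_smul, inv_mul_cancel₀ ht0.ne', one_smul]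
    rw [e, norm_smul, norm_inv, Real.norm_of_nonneg ht0.le, inv_mul_le_iff₀ ht0]
    refine h2.trans (le_of_eq ?_)
    push_cast
    ring

end IsLocalApproximation

end Approximation

/-! ### The generator of the PEP on local functions. -/

variable {κ : ℕ}

theorem jump_apply (η : Config κ) (x y z : ℤ) :
    jump η x y z = if η x ≠ 0 ∧ η y ≠ Fin.last κ then
      (if z = y then η y + 1 else if z = x then η x - 1 else η z) else η z := by
  rw [jump]
  split_ifs with h h1 h2
  · subst h1; simp
  · subst h2; simp [h1]
  · simp [h1, h2]
  · rfl

theorem jump_apply_of_ne (η : Config κ) {x y z : ℤ} (hx : z ≠ x) (hy : z ≠ y) :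
    jump η x y z = η z := by
  simp [jump_apply, hx, hy]

theorem continuous_jump (x y : ℤ) : Continuous fun η : Config κ => jump η x y := by
  refine continuous_pi fun z => ?_
  simp_rw [jump_apply]
  exact (continuous_of_discreteTopology (f := fun t : Fin (κ + 1) × Fin (κ + 1) × Fin (κ + 1) =>
    if t.1 ≠ 0 ∧ t.2.1 ≠ Fin.last κ then
      (if z = y then t.2.1 + 1 else if z = x then t.1 - 1 else t.2.2) else t.2.2)).comp
    (f := fun η : Config κ => (η x, η y, η z)) (by fun_prop)

/-- The map `η ↦ η^{x,y}`. -/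
def jumpMap (x y : ℤ) : C(Config κ, Config κ) := ⟨fun η => jump η x y, continuous_jump x y⟩

/-- The function `η ↦ F (η x) (η y)` of two occupation variables. -/
def pairFn (F : Fin (κ + 1) → Fin (κ + 1) → ℝ) (x y : ℤ) : C(Config κ, ℝ) :=
  ⟨fun η => F (η x) (η y),
    (continuous_of_discreteTopology (f := fun t : Fin (κ + 1) × Fin (κ + 1) => F t.1 t.2)).comp
      (f := fun η : Config κ => (η x, η y)) (by fun_prop)⟩

@[simp] theorem pairFn_apply (F : Fin (κ + 1) → Fin (κ + 1) → ℝ) (x y : ℤ) (η : Config κ) :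
    pairFn F x y η = F (η x) (η y) := rfl

/-- A bound of a rate function. -/
def rateBound (r : Fin (κ + 1) → Fin (κ + 1) → ℝ) : ℝ := ∑ a, ∑ b, |r a b|

theorem rateBound_nonneg (r : Fin (κ + 1) → Fin (κ + 1) → ℝ) : 0 ≤ rateBound r :=
  Finset.sum_nonneg fun _ _ => Finset.sum_nonneg fun _ _ => abs_nonneg _

theorem abs_le_rateBound (r : Fin (κ + 1) → Fin (κ + 1) → ℝ) (a b : Fin (κ + 1)) :
    |r a b| ≤ rateBound r :=
  (Finset.single_le_sum (f := fun b => |r a b|) (fun _ _ => abs_nonneg _)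
    (Finset.mem_univ b)).trans
    (Finset.single_le_sum (f := fun a => ∑ b, |r a b|)
      (fun _ _ => Finset.sum_nonneg fun _ _ => abs_nonneg _) (Finset.mem_univ a))

theorem norm_pairFn_mul_le (r : Fin (κ + 1) → Fin (κ + 1) → ℝ) (x y : ℤ) (f : C(Config κ, ℝ)) :
    ‖pairFn r x y * (f.comp (jumpMap x y) - f)‖ ≤ 2 * rateBound r * ‖f‖ := by
  have hB := rateBound_nonneg r
  rw [ContinuousMap.norm_le _ (by positivity)]
  intro η
  change ‖r (η x) (η y) * (f (jump η x y) - f η)‖ ≤ _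
  rw [norm_mul]
  have h1 : ‖f (jump η x y) - f η‖ ≤ ‖f‖ + ‖f‖ :=
    (norm_sub_le _ _).trans (add_le_add (f.norm_coe_le_norm _) (f.norm_coe_le_norm _))
  calc ‖r (η x) (η y)‖ * ‖f (jump η x y) - f η‖ ≤ rateBound r * (‖f‖ + ‖f‖) := by
        gcongr
        exact abs_le_rateBound r _ _
    _ = _ := by ring

/-- The generator of the jumps from `x` to `y`. -/
noncomputable def jumpOp (r : Fin (κ + 1) → Fin (κ + 1) → ℝ) (x y : ℤ) :
    C(Config κ, ℝ) →L[ℝ] C(Config κ, ℝ) :=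
  LinearMap.mkContinuous
    { toFun := fun f => pairFn r x y * (f.comp (jumpMap x y) - f)
      map_add' := fun f g => by
        ext η
        simp
        ring
      map_smul' := fun a f => by
        ext η
        simp
        ring }
    (2 * rateBound r) (norm_pairFn_mul_le r x y)

theorem jumpOp_apply (r : Fin (κ + 1) → Fin (κ + 1) → ℝ) (x y : ℤ) (f : C(Config κ, ℝ))
    (η : Config κ) : jumpOp r x y f η = r (η x) (η y) * grad x y f η := rfl

theorem norm_jumpOp_apply_le (r : Fin (κ + 1) → Fin (κ + 1) → ℝ) (x y : ℤ)
    (f : C(Config κ, ℝ)) : ‖jumpOp r x y f‖ ≤ 2 * rateBound r * ‖f‖ :=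
  norm_pairFn_mul_le r x y f

/-- With `R` the rate bound, `r (f(η^{x,y}) - f(η)) + R f(η)` equals `r f(η^{x,y}) + (R - r) f(η)`,
and both terms are nonnegative for `f ≥ 0`. -/
theorem isMarkovGenerator_jumpOp {r : Fin (κ + 1) → Fin (κ + 1) → ℝ} (hr : ∀ a b, 0 ≤ r a b)
    (x y : ℤ) : IsMarkovGenerator (jumpOp r x y) := by
  refine ⟨?_, rateBound r, fun f hf η => ?_⟩
  · ext η
    simp [jumpOp_apply, grad]
  · change 0 ≤ r (η x) (η y) * (f (jump η x y) - f η) + rateBound r * f η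
    have h1 : 0 ≤ f η := hf η
    have h2 : 0 ≤ f (jump η x y) := hf _
    have h3 := (le_abs_self _).trans (abs_le_rateBound r (η x) (η y))
    have h4 := hr (η x) (η y)
    nlinarith [mul_nonneg h4 h2, mul_nonneg (sub_nonneg.2 h3) h1]

theorem dependsOn_jumpOp (r : Fin (κ + 1) → Fin (κ + 1) → ℝ) {x y : ℤ} {f : C(Config κ, ℝ)}
    {A B : Set ℤ} (hf : DependsOn f A) (hAB : A ⊆ B) (hx : x ∈ B) (hy : y ∈ B) :
    DependsOn (jumpOp r x y f) B := by
  intro η ξ h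
  rw [jumpOp_apply, jumpOp_apply, grad, grad, h x hx, h y hy, hf fun z hz => h z (hAB hz)]
  congr 2
  refine hf fun z hz => ?_
  rw [jump_apply, jump_apply, h x hx, h y hy, h z (hAB hz)]

theorem jumpOp_eq_zero (r : Fin (κ + 1) → Fin (κ + 1) → ℝ) {x y : ℤ} {f : C(Config κ, ℝ)}
    {A : Set ℤ} (hf : DependsOn f A) (hx : x ∉ A) (hy : y ∉ A) : jumpOp r x y f = 0 := by
  ext η
  have : f (jump η x y) = f η := hf fun z hz =>
    jump_apply_of_ne η (fun h => hx (h ▸ hz)) (fun h => hy (h ▸ hz))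
  simp [jumpOp_apply, grad, this]

/-- The generator of the jumps across the bond `{x, x + 1}`. -/
noncomputable def bondOp (n p q : ℝ) (r : Fin (κ + 1) → Fin (κ + 1) → ℝ) (x : ℤ) :
    C(Config κ, ℝ) →L[ℝ] C(Config κ, ℝ) :=
  (n ^ 2 * p) • jumpOp r x (x + 1) + (n ^ 2 * q) • jumpOp r (x + 1) x

theorem bondOp_apply (n p q : ℝ) (r : Fin (κ + 1) → Fin (κ + 1) → ℝ) (x : ℤ)
    (f : C(Config κ, ℝ)) :
    bondOp n p q r x f = (n ^ 2 * p) • jumpOp r x (x + 1) f + (n ^ 2 * q) • jumpOp r (x + 1) x f :=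
  rfl

theorem bondOp_eq_zero (n p q : ℝ) (r : Fin (κ + 1) → Fin (κ + 1) → ℝ) {x : ℤ}
    {f : C(Config κ, ℝ)} {A : Set ℤ} (hf : DependsOn f A) (hx : x ∉ A) (hy : x + 1 ∉ A) :
    bondOp n p q r x f = 0 := by
  rw [bondOp_apply, jumpOp_eq_zero r hf hx hy, jumpOp_eq_zero r hf hy hx, smul_zero, smul_zero,
    add_zero]

theorem norm_bondOp_apply_le {n p q : ℝ} (hp : 0 ≤ p) (hq : 0 ≤ q) (hpq : p + q = 1)
    (r : Fin (κ + 1) → Fin (κ + 1) → ℝ) (x : ℤ) (f : C(Config κ, ℝ)) :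
    ‖bondOp n p q r x f‖ ≤ n ^ 2 * (2 * rateBound r) * ‖f‖ := by
  rw [bondOp_apply]
  refine (norm_add_le _ _).trans ?_
  rw [norm_smul, norm_smul, Real.norm_of_nonneg (by positivity),
    Real.norm_of_nonneg (by positivity)]
  calc n ^ 2 * p * ‖jumpOp r x (x + 1) f‖ + n ^ 2 * q * ‖jumpOp r (x + 1) x f‖
      ≤ n ^ 2 * p * (2 * rateBound r * ‖f‖) + n ^ 2 * q * (2 * rateBound r * ‖f‖) := by
        gcongr <;> exact norm_jumpOp_apply_le r _ _ f
    _ = n ^ 2 * (2 * rateBound r) * ‖f‖ * (p + q) := by ring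
    _ = _ := by rw [hpq, mul_one]

theorem generator_eq_sum (n p q : ℝ) (r : Fin (κ + 1) → Fin (κ + 1) → ℝ) {f : C(Config κ, ℝ)}
    {A : Set ℤ} (hf : DependsOn f A) {s : Finset ℤ} (hs : ∀ x ∉ s, x ∉ A ∧ x + 1 ∉ A)
    (η : Config κ) : generator n p q r f η = (∑ x ∈ s, bondOp n p q r x f) η := by
  have hzero : ∀ {x y : ℤ}, x ∉ A → y ∉ A → r (η x) (η y) * grad x y f η = 0 := by
    intro x y hx hy
    rw [← jumpOp_apply, jumpOp_eq_zero r hf hx hy]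
    rfl
  have h1 : ∑' x : ℤ, p * r (η x) (η (x + 1)) * grad x (x + 1) f η =
      ∑ x ∈ s, p * r (η x) (η (x + 1)) * grad x (x + 1) f η := by
    refine tsum_eq_sum fun x hx => ?_
    rw [mul_assoc, hzero (hs x hx).1 (hs x hx).2, mul_zero]
  have h2 : ∑' x : ℤ, q * r (η x) (η (x - 1)) * grad x (x - 1) f η =
      ∑ x ∈ s, q * r (η (x + 1)) (η x) * grad (x + 1) x f η := by
    -- The shift by one attaches the left jump from `x + 1` to the bond `{x, x + 1}`, so that both
    -- directions are indexed by bonds.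
    rw [← (Equiv.addRight (1 : ℤ)).tsum_eq]
    simp only [Equiv.coe_addRight, add_sub_cancel_right]
    refine tsum_eq_sum fun x hx => ?_
    rw [mul_assoc, hzero (hs x hx).2 (hs x hx).1, mul_zero]
  rw [generator, h1, h2, ContinuousMap.sum_apply, Finset.mul_sum, Finset.mul_sum,
    ← Finset.sum_add_distrib]
  refine Finset.sum_congr rfl fun x _ => ?_
  rw [bondOp_apply]
  change _ = (n ^ 2 * p) * (jumpOp r x (x + 1) f η) + (n ^ 2 * q) * (jumpOp r (x + 1) x f η)
  rw [jumpOp_apply, jumpOp_apply]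
  ring

/-- The generator of the process on the box `[-N, N]`. -/
noncomputable def boxOp (n p q : ℝ) (r : Fin (κ + 1) → Fin (κ + 1) → ℝ) (N : ℕ) :
    C(Config κ, ℝ) →L[ℝ] C(Config κ, ℝ) :=
  ∑ x ∈ Finset.Ico (-(N : ℤ)) N, bondOp n p q r x

theorem boxOp_apply (n p q : ℝ) (r : Fin (κ + 1) → Fin (κ + 1) → ℝ) (N : ℕ)
    (f : C(Config κ, ℝ)) :
    boxOp n p q r N f = ∑ x ∈ Finset.Ico (-(N : ℤ)) N, bondOp n p q r x f := by
  rw [boxOp]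
  exact sum_apply _ _ _

/-- The functions that depend on the occupation variables in `[-m, m]` only. -/
def boxFunctions (κ m : ℕ) : Set C(Config κ, ℝ) := {f | DependsOn f (Set.Icc (-(m : ℤ)) m)}

theorem isLocal_iff_exists_mem_boxFunctions {f : C(Config κ, ℝ)} :
    IsLocal f ↔ ∃ m, f ∈ boxFunctions κ m := by
  constructor
  · rintro ⟨A, hA⟩
    refine ⟨∑ x ∈ A, x.natAbs, fun η ξ h => hA fun x hx => h x ?_⟩
    have := Finset.single_le_sum (f := fun x : ℤ => x.natAbs) (fun _ _ => Nat.zero_le _) hx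
    simp only [Set.mem_Icc]
    omega
  · rintro ⟨m, hm⟩
    exact ⟨Finset.Icc (-(m : ℤ)) m, by rwa [Finset.coe_Icc]⟩

/-- Stone–Weierstrass: the local functions form a subalgebra, and occupation numbers separate
configurations. -/
theorem dense_boxFunctions (κ : ℕ) : Dense (⋃ m, boxFunctions κ m) := by
  let 𝓐 : Subalgebra ℝ C(Config κ, ℝ) :=
    { carrier := {f | IsLocal f}
      mul_mem' := by
        rintro f g ⟨A, hA⟩ ⟨B, hB⟩
        refine ⟨A ∪ B, fun η ξ h => ?_⟩
        rw [ContinuousMap.mul_apply, ContinuousMap.mul_apply,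
          hA fun x hx => h x (by simp_all), hB fun x hx => h x (by simp_all)]
      add_mem' := by
        rintro f g ⟨A, hA⟩ ⟨B, hB⟩
        refine ⟨A ∪ B, fun η ξ h => ?_⟩
        rw [ContinuousMap.add_apply, ContinuousMap.add_apply,
          hA fun x hx => h x (by simp_all), hB fun x hx => h x (by simp_all)]
      algebraMap_mem' := fun a => ⟨∅, fun η ξ h => rfl⟩ }
  have hsep : 𝓐.SeparatesPoints := by
    intro η ξ hne
    obtain ⟨x, hx⟩ := Function.ne_iff.1 hne
    refine ⟨_, ⟨pairFn (fun a _ => ((a : ℕ) : ℝ)) x x, ⟨{x}, fun η ξ h => ?_⟩, rfl⟩, ?_⟩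
    · rw [pairFn_apply, pairFn_apply, h x (by simp)]
    · simpa [Fin.val_inj] using hx
  have h := ContinuousMap.subalgebra_topologicalClosure_eq_top_of_separatesPoints 𝓐 hsep
  have hU : (⋃ m, boxFunctions κ m) = (𝓐 : Set C(Config κ, ℝ)) := by
    ext f
    rw [Set.mem_iUnion]
    exact isLocal_iff_exists_mem_boxFunctions.symm
  rw [hU, dense_iff_closure_eq, ← Subalgebra.topologicalClosure_coe, h]
  rfl

theorem notMem_Icc_of_notMem_Ico {m : ℕ} {x : ℤ}
    (hx : x ∉ Finset.Ico (-((m + 1 : ℕ) : ℤ)) ((m + 1 : ℕ) : ℤ)) :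
    x ∉ Set.Icc (-(m : ℤ)) m ∧ x + 1 ∉ Set.Icc (-(m : ℤ)) m := by
  simp only [Finset.mem_Ico, Set.mem_Icc] at *
  omega

theorem boxOp_apply_eq_sum_inter (n p q : ℝ) (r : Fin (κ + 1) → Fin (κ + 1) → ℝ) {m : ℕ}
    {f : C(Config κ, ℝ)} (hf : f ∈ boxFunctions κ m) (N : ℕ) :
    boxOp n p q r N f = ∑ x ∈ Finset.Ico (-(N : ℤ)) N ∩
      Finset.Ico (-((m + 1 : ℕ) : ℤ)) ((m + 1 : ℕ) : ℤ), bondOp n p q r x f := by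
  rw [boxOp_apply]
  refine (Finset.sum_subset Finset.inter_subset_left fun x hx hx' => ?_).symm
  have h := notMem_Icc_of_notMem_Ico fun h => hx' (Finset.mem_inter.2 ⟨hx, h⟩)
  exact bondOp_eq_zero n p q r hf h.1 h.2

theorem dependsOn_sum {ι : Type*} {A : Set ℤ} {s : Finset ι} {F : ι → C(Config κ, ℝ)}
    (h : ∀ i ∈ s, DependsOn (F i) A) : DependsOn (∑ i ∈ s, F i : C(Config κ, ℝ)) A := by
  intro η ξ hηξ
  rw [ContinuousMap.sum_apply, ContinuousMap.sum_apply]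
  exact Finset.sum_congr rfl fun i hi => h i hi hηξ

theorem dependsOn_bondOp (n p q : ℝ) (r : Fin (κ + 1) → Fin (κ + 1) → ℝ) {x : ℤ}
    {f : C(Config κ, ℝ)} {A B : Set ℤ} (hf : DependsOn f A) (hAB : A ⊆ B) (hx : x ∈ B)
    (hy : x + 1 ∈ B) : DependsOn (bondOp n p q r x f) B := by
  intro η ξ h
  have h1 := dependsOn_jumpOp r hf hAB hx hy h
  have h2 := dependsOn_jumpOp r hf hAB hy hx h
  change (n ^ 2 * p) * (jumpOp r x (x + 1) f η) + (n ^ 2 * q) * (jumpOp r (x + 1) x f η) =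
    (n ^ 2 * p) * (jumpOp r x (x + 1) f ξ) + (n ^ 2 * q) * (jumpOp r (x + 1) x f ξ)
  rw [h1, h2]

/-- At most `2 (m + 1)` bonds meet `[-m, m]`, and each bond operator has norm at most `n² * 2 *
rateBound r` because `p + q = 1`. This is the origin of the constant. -/
theorem isLocalApproximation {n p q : ℝ} (hp : 0 ≤ p) (hq : 0 ≤ q) (hpq : p + q = 1)
    {r : Fin (κ + 1) → Fin (κ + 1) → ℝ} (hr : ∀ a b, 0 ≤ r a b) :
    IsLocalApproximation (boxFunctions κ) (boxOp n p q r)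
      (Real.toNNReal (2 * (n ^ 2 * (2 * rateBound r)))) where
  dense := dense_boxFunctions κ
  generator N := IsMarkovGenerator.sum _ fun x _ =>
    ((isMarkovGenerator_jumpOp hr _ _).smul (by positivity)).add
      ((isMarkovGenerator_jumpOp hr _ _).smul (by positivity))
  mem := by
    intro m f N hf
    rw [boxOp_apply_eq_sum_inter n p q r hf]
    refine dependsOn_sum fun x hx => ?_
    have hx' := (Finset.mem_inter.1 hx).2
    rw [Finset.mem_Ico] at hx'
    refine dependsOn_bondOp n p q r hf (Set.Icc_subset_Icc ?_ ?_) ?_ ?_ <;>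
      (try simp only [Set.mem_Icc]) <;> omega
  stable := by
    intro m f N hf hN
    rw [boxOp_apply_eq_sum_inter n p q r hf, boxOp_apply, Finset.inter_eq_right.2]
    refine Finset.Ico_subset_Ico ?_ ?_ <;> omega
  bound := by
    intro m f N hf
    have hB := rateBound_nonneg r
    rw [boxOp_apply_eq_sum_inter n p q r hf, Real.coe_toNNReal _ (by positivity)]
    refine (norm_sum_le_of_le _ fun x _ => norm_bondOp_apply_le hp hq hpq r x f).trans ?_
    rw [Finset.sum_const, nsmul_eq_mul]
    have hcard : ((Finset.Ico (-(N : ℤ)) N ∩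
        Finset.Ico (-((m + 1 : ℕ) : ℤ)) ((m + 1 : ℕ) : ℤ)).card : ℝ) ≤ 2 * (m + 1) := by
      have := Finset.card_le_card (Finset.inter_subset_right (s₁ := Finset.Ico (-(N : ℤ)) N)
        (s₂ := Finset.Ico (-((m + 1 : ℕ) : ℤ)) ((m + 1 : ℕ) : ℤ)))
      rw [Int.card_Ico] at this
      have h2 : (((m + 1 : ℕ) : ℤ) - -((m + 1 : ℕ) : ℤ)).toNat = 2 * (m + 1) := by omega
      rw [h2] at this
      exact_mod_cast this
    calc _ ≤ 2 * ((m : ℝ) + 1) * (n ^ 2 * (2 * rateBound r) * ‖f‖) := by gcongr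
      _ = _ := by ring

/-- The box of radius `m + 1` already contains every bond that meets `[-m, m]`, so there `boxOp`
coincides with `L_n`. -/
theorem isPEPSemigroup_iff {n p q : ℝ} {r : Fin (κ + 1) → Fin (κ + 1) → ℝ}
    {S : ℝ≥0 → C(Config κ, ℝ) →ₗ[ℝ] C(Config κ, ℝ)} :
    IsPEPSemigroup n p q r S ↔ IsMarkovSemigroup S ∧
      IsLocalApproximation.Generates (boxFunctions κ) (boxOp n p q r) S := by
  have hgen : ∀ {m : ℕ} {f : C(Config κ, ℝ)}, f ∈ boxFunctions κ m → ∀ η,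
      boxOp n p q r (m + 1) f η = generator n p q r f η := by
    intro m f hf η
    rw [boxOp_apply, generator_eq_sum n p q r hf fun x => notMem_Icc_of_notMem_Ico]
  constructor
  · refine fun h => ⟨h.markov, fun m f hf => ?_⟩
    obtain ⟨g, hg, hgS⟩ := h.generated f (isLocal_iff_exists_mem_boxFunctions.2 ⟨m, hf⟩)
    have : g = boxOp n p q r (m + 1) f := ContinuousMap.ext fun η => by rw [hg, hgen hf]
    rwa [← this]
  · refine fun h => ⟨h.1, fun f hf => ?_⟩
    obtain ⟨m, hm⟩ := isLocal_iff_exists_mem_boxFunctions.1 hf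
    exact ⟨_, hgen hm, h.2 m f hm⟩

theorem existsUnique_isPEPSemigroup {n p q : ℝ} (hp : 0 ≤ p) (hq : 0 ≤ q) (hpq : p + q = 1)
    {r : Fin (κ + 1) → Fin (κ + 1) → ℝ} (hr : ∀ a b, 0 ≤ r a b) :
    ∃! S : ℝ≥0 → C(Config κ, ℝ) →ₗ[ℝ] C(Config κ, ℝ), IsPEPSemigroup n p q r S := by
  have h := isLocalApproximation (n := n) hp hq hpq hr
  simp only [isPEPSemigroup_iff]
  obtain ⟨S, hS, hST⟩ := h.exists_semigroup
  exact ⟨S, ⟨hS, hST⟩, fun S' hS' => h.semigroup_unique hS'.1 hS'.2 hS hST⟩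

/-! ### Expectations under product measures. -/

section Integral

variable {X : Type*} [TopologicalSpace X] [CompactSpace X] [MeasurableSpace X]
  [OpensMeasurableSpace X]

theorem integrable_continuousMap (ν : Measure X) [IsFiniteMeasure ν] (f : C(X, ℝ)) :
    Integrable (fun x => f x) ν :=
  (integrable_const ‖f‖).mono' f.continuous.aestronglyMeasurable
    (Eventually.of_forall fun x => f.norm_coe_le_norm x)

/-- Integration against a probability measure, as a functional on continuous functions. -/
noncomputable def integralCLM (ν : Measure X) [IsProbabilityMeasure ν] : C(X, ℝ) →L[ℝ] ℝ :=
  LinearMap.mkContinuous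
    { toFun := fun f => ∫ x, f x ∂ν
      map_add' := fun f g =>
        integral_add (integrable_continuousMap ν f) (integrable_continuousMap ν g)
      map_smul' := fun a f => integral_const_mul a fun x => f x }
    1 fun f => by
      simpa using norm_integral_le_of_norm_le_const (μ := ν)
        (Eventually.of_forall fun x => f.norm_coe_le_norm x)

theorem integralCLM_apply (ν : Measure X) [IsProbabilityMeasure ν] (f : C(X, ℝ)) :
    integralCLM ν f = ∫ x, f x ∂ν := rfl

theorem integralCLM_one (ν : Measure X) [IsProbabilityMeasure ν] : integralCLM ν 1 = 1 := by
  simp [integralCLM_apply]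

end Integral

/-- Resampling one coordinate independently preserves a product measure, as cylinder sets show. It
serves to condition on the occupation of a site. -/
theorem infinitePi_map_update {ι : Type*} [DecidableEq ι] {Y : ι → Type*}
    [∀ i, MeasurableSpace (Y i)] (μ : ∀ i, Measure (Y i)) [∀ i, IsProbabilityMeasure (μ i)]
    (i : ι) :
    ((Measure.infinitePi μ).prod (μ i)).map (fun t => Function.update t.1 i t.2) =
      Measure.infinitePi μ := by
  have hmeas : Measurable fun t : (∀ j, Y j) × Y i => Function.update t.1 i t.2 :=
    measurable_update'
  refine Measure.eq_infinitePi μ fun s t ht => ?_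
  rw [Measure.map_apply hmeas (MeasurableSet.pi s.countable_toSet fun j _ => ht j)]
  have hpre : (fun t : (∀ j, Y j) × Y i => Function.update t.1 i t.2) ⁻¹' (s : Set ι).pi t =
      ((s.erase i : Finset ι) : Set ι).pi t ×ˢ (if i ∈ s then t i else Set.univ) := by
    ext ⟨η, a⟩
    simp only [Set.mem_preimage, Set.mem_pi, Finset.mem_coe, Set.mem_prod, Finset.mem_erase]
    constructor
    · refine fun h => ⟨fun j hj => by simpa [hj.1] using h j hj.2, ?_⟩
      split_ifs with hi
      · simpa using h i hi
      · trivial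
    · rintro ⟨h, h'⟩ j hj
      by_cases hji : j = i
      · subst hji
        simpa [hj] using h'
      · simpa [hji] using h j ⟨hji, hj⟩
  rw [hpre, Measure.prod_prod, Measure.infinitePi_pi μ fun j _ => ht j]
  split_ifs with hi
  · rw [Finset.prod_erase_mul s (fun j => μ j (t j)) hi]
  · rw [Finset.erase_eq_of_notMem hi, measure_univ, mul_one]
/-- The map that sets the occupation number of `x` to `a`. -/
def updateMap (x : ℤ) (a : Fin (κ + 1)) : C(Config κ, Config κ) :=
  ⟨fun η => Function.update η x a, continuous_id.update x continuous_const⟩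

/-- The function `η ↦ h (η x)` of one occupation variable. -/
def siteFn (h : Fin (κ + 1) → ℝ) (x : ℤ) : C(Config κ, ℝ) :=
  ⟨fun η => h (η x), continuous_of_discreteTopology.comp (continuous_apply x)⟩

/-! ### Detailed balance, and the gradient condition against stationarity. -/

section Product

variable (μ : Measure (Fin (κ + 1))) [IsProbabilityMeasure μ]

/-- The expectation under the homogeneous product measure with marginal `μ`. -/
noncomputable def expect : C(Config κ, ℝ) →L[ℝ] ℝ :=
  integralCLM (Measure.infinitePi fun _ : ℤ => μ)

theorem expect_one : expect μ 1 = 1 := integralCLM_one _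

theorem expect_eq_sum_update (x : ℤ) (F : C(Config κ, ℝ)) :
    expect μ F = ∑ a, μ.real {a} * expect μ (F.comp (updateMap x a)) := by
  have hcont : Continuous fun t : Config κ × Fin (κ + 1) => Function.update t.1 x t.2 :=
    continuous_fst.update x continuous_snd
  have h := infinitePi_map_update (fun _ : ℤ => μ) x
  rw [expect, integralCLM_apply]
  conv_lhs => rw [← h]
  rw [integral_map hcont.measurable.aemeasurable
    F.continuous.aestronglyMeasurable, integral_prod_symm]
  · rw [integral_fintype Integrable.of_finite]
    rfl
  · exact integrable_continuousMap _ (F.comp ⟨_, hcont⟩)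

/-- Independence: after conditioning on `η x`, the factor `f` does not see the value at `x`. -/
theorem expect_siteFn_mul (h : Fin (κ + 1) → ℝ) {x : ℤ} {f : C(Config κ, ℝ)} {A : Set ℤ}
    (hf : DependsOn f A) (hx : x ∉ A) :
    expect μ (siteFn h x * f) = (∑ a, μ.real {a} * h a) * expect μ f := by
  rw [expect_eq_sum_update μ x, Finset.sum_mul]
  refine Finset.sum_congr rfl fun a _ => ?_
  have : (siteFn h x * f).comp (updateMap x a) = h a • f := by
    ext η
    change h (Function.update η x a x) * f (Function.update η x a) = h a * f η
    rw [Function.update_self, hf fun z hz =>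
      Function.update_of_ne (fun e : z = x => hx (e ▸ hz)) a η]
  rw [this, map_smul, smul_eq_mul, mul_assoc]

/-- The detailed balance equations of the jump rate `r` with respect to the marginal `μ`. -/
structure DetailedBalance (r : Fin (κ + 1) → Fin (κ + 1) → ℝ) (μ : Measure (Fin (κ + 1))) :
    Prop where
  zero_left : ∀ b, r 0 b = 0
  last_right : ∀ a, r a (Fin.last κ) = 0
  balance : ∀ i j : Fin κ, μ.real {i.succ} * μ.real {j.castSucc} * r i.succ j.castSucc =
    μ.real {i.castSucc} * μ.real {j.succ} * r j.succ i.castSucc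

/-- The values `i.succ` at `x` and `j.castSucc` at `y` parametrize exactly the nonempty source and
non-full target, so the jump is not suppressed and arithmetic in `Fin` does not wrap around. -/
theorem jump_update_update {x y : ℤ} (hxy : x ≠ y) (η : Config κ) (i j : Fin κ) :
    jump (Function.update (Function.update η y j.castSucc) x i.succ) x y =
      Function.update (Function.update η y j.succ) x i.castSucc := by
  have h1 : i.succ - 1 = i.castSucc := by
    rw [sub_eq_iff_eq_add, Fin.coeSucc_eq_succ]
  funext z
  rw [jump_apply]
  by_cases hzx : z = x
  · subst hzx
    simp [hxy, hxy.symm, Fin.succ_ne_zero, Fin.castSucc_ne_last, h1]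
  · by_cases hzy : z = y
    · subst hzy
      simp [hxy.symm, Fin.succ_ne_zero, Fin.castSucc_ne_last]
    · simp [hzx, hzy]

theorem expect_eq_sum_update_update (x y : ℤ) (F : C(Config κ, ℝ)) :
    expect μ F = ∑ a, ∑ b, μ.real {a} * μ.real {b} *
      expect μ ((F.comp (updateMap x a)).comp (updateMap y b)) := by
  rw [expect_eq_sum_update μ x]
  refine Finset.sum_congr rfl fun a _ => ?_
  rw [expect_eq_sum_update μ y, Finset.mul_sum]
  exact Finset.sum_congr rfl fun b _ => by rw [mul_assoc]

variable {μ} in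
-- Both sides are expanded over the occupations of `x` and `y`. On the left an empty `x` or a full
-- `y` contributes zero, on the right a full `x` or an empty `y`; detailed balance matches the
-- remaining terms one by one.
theorem DetailedBalance.expect_jump {r : Fin (κ + 1) → Fin (κ + 1) → ℝ}
    (hr : DetailedBalance r μ) {x y : ℤ} (hxy : x ≠ y) (f : C(Config κ, ℝ)) :
    expect μ (pairFn r x y * f.comp (jumpMap x y)) = expect μ (pairFn r y x * f) := by
  have hl : ∀ a b, ((pairFn r x y * f.comp (jumpMap x y)).comp (updateMap x a)).comp
      (updateMap y b) =
      r a b • (((f.comp (jumpMap x y)).comp (updateMap x a)).comp (updateMap y b)) := by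
    intro a b
    ext η
    change r (Function.update (Function.update η y b) x a x)
      (Function.update (Function.update η y b) x a y) * _ = r a b * _
    rw [Function.update_self, Function.update_of_ne hxy.symm, Function.update_self]
    rfl
  have hr' : ∀ a b, ((pairFn r y x * f).comp (updateMap x a)).comp (updateMap y b) =
      r b a • ((f.comp (updateMap x a)).comp (updateMap y b)) := by
    intro a b
    ext η
    change r (Function.update (Function.update η y b) x a y)
      (Function.update (Function.update η y b) x a x) * _ = r b a * _
    rw [Function.update_self, Function.update_of_ne hxy.symm, Function.update_self]
    rfl
  rw [expect_eq_sum_update_update μ x y, expect_eq_sum_update_update μ x y (pairFn r y x * f)]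
  simp_rw [hl, hr', map_smul, smul_eq_mul]
  rw [Fin.sum_univ_succ, Finset.sum_eq_zero (fun b _ => by simp [hr.zero_left]), zero_add,
    Fin.sum_univ_castSucc (n := κ), Finset.sum_eq_zero
      (fun b _ => by simp [hr.last_right] : ∀ b ∈ Finset.univ, μ.real {Fin.last κ} * μ.real {b} *
        (r b (Fin.last κ) *
          expect μ ((f.comp (updateMap x (Fin.last κ))).comp (updateMap y b))) = 0), add_zero]
  refine Finset.sum_congr rfl fun i _ => ?_
  rw [Fin.sum_univ_castSucc, Fin.sum_univ_succ, hr.last_right, hr.zero_left]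
  simp only [zero_mul, mul_zero, add_zero, zero_add]
  refine Finset.sum_congr rfl fun j _ => ?_
  have : ((f.comp (jumpMap x y)).comp (updateMap x i.succ)).comp (updateMap y j.castSucc) =
      (f.comp (updateMap x i.castSucc)).comp (updateMap y j.succ) := by
    ext η
    exact congrArg f (jump_update_update hxy η i j)
  rw [this, ← mul_assoc, ← mul_assoc, hr.balance]

variable {μ} in
theorem DetailedBalance.expect_jumpOp {r : Fin (κ + 1) → Fin (κ + 1) → ℝ}
    (hr : DetailedBalance r μ) {x y : ℤ} (hxy : x ≠ y) (f : C(Config κ, ℝ)) :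
    expect μ (jumpOp r x y f) = expect μ (pairFn (fun a b => r b a - r a b) x y * f) := by
  have h1 : jumpOp r x y f = pairFn r x y * f.comp (jumpMap x y) - pairFn r x y * f :=
    mul_sub _ _ _
  have h2 : pairFn (fun a b => r b a - r a b) x y * f = pairFn r y x * f - pairFn r x y * f := by
    ext η
    exact sub_mul _ _ _
  rw [h1, h2, map_sub, map_sub, hr.expect_jump hxy]

variable {μ} in
-- The two jump directions yield the same antisymmetric function with opposite signs, hence the
-- factor `p - q`.
theorem DetailedBalance.expect_bondOp {r : Fin (κ + 1) → Fin (κ + 1) → ℝ}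
    (hr : DetailedBalance r μ) (n p q : ℝ) (x : ℤ) (f : C(Config κ, ℝ)) :
    expect μ (bondOp n p q r x f) =
      n ^ 2 * (p - q) * expect μ (pairFn (fun a b => r b a - r a b) x (x + 1) * f) := by
  have h : pairFn (fun a b => r b a - r a b) (x + 1) x * f =
      -(pairFn (fun a b => r b a - r a b) x (x + 1) * f) := by
    ext η
    simp
    ring
  rw [bondOp_apply, map_add, map_smul, map_smul, hr.expect_jumpOp (by simp),
    hr.expect_jumpOp (by simp), h, map_neg]
  simp
  ring

theorem sum_Ico_neg_sub (G : ℤ → ℝ) (N : ℕ) :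
    ∑ x ∈ Finset.Ico (-(N : ℤ)) N, (G (x + 1) - G x) = G N - G (-N) := by
  induction N with
  | zero => simp
  | succ N ih =>
    have e : Finset.Ico (-((N + 1 : ℕ) : ℤ)) ((N + 1 : ℕ) : ℤ) =
        insert (N : ℤ) (insert (-(N : ℤ) - 1) (Finset.Ico (-(N : ℤ)) N)) := by
      ext x
      simp only [Finset.mem_Ico, Finset.mem_insert]
      omega
    have h1 : (N : ℤ) ∉ insert (-(N : ℤ) - 1) (Finset.Ico (-(N : ℤ)) N) := by
      simp only [Finset.mem_Ico, Finset.mem_insert]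
      omega
    have h2 : -(N : ℤ) - 1 ∉ Finset.Ico (-(N : ℤ)) N := by
      simp only [Finset.mem_Ico]
      omega
    rw [e, Finset.sum_insert h1, Finset.sum_insert h2, ih, sub_add_cancel]
    push_cast
    rw [neg_add, ← sub_eq_add_neg (-(N : ℤ))]
    ring

variable {μ} in
-- The sum over bonds telescopes to the sites `±(m + 1)`. Both lie outside `[-m, m]`, so `h(η_x)`
-- factors out of the expectation with the same mean at either end.
theorem DetailedBalance.expect_boxOp_eq_zero {r : Fin (κ + 1) → Fin (κ + 1) → ℝ}
    (hr : DetailedBalance r μ) {h : Fin (κ + 1) → ℝ}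
    (hgrad : ∀ a b, r b a - r a b = 2 * (h b - h a)) (n p q : ℝ) {m : ℕ} {f : C(Config κ, ℝ)}
    (hf : f ∈ boxFunctions κ m) : expect μ (boxOp n p q r (m + 1) f) = 0 := by
  have hx : ∀ x : ℤ, expect μ (bondOp n p q r x f) = n ^ 2 * (p - q) * 2 *
      (expect μ (siteFn h (x + 1) * f) - expect μ (siteFn h x * f)) := by
    intro x
    have e : pairFn (fun a b => r b a - r a b) x (x + 1) * f =
        (2 : ℝ) • (siteFn h (x + 1) * f - siteFn h x * f) := by
      ext η
      change (r (η (x + 1)) (η x) - r (η x) (η (x + 1))) * f η =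
        2 * (h (η (x + 1)) * f η - h (η x) * f η)
      rw [hgrad]
      ring
    rw [hr.expect_bondOp, e, map_smul, map_sub, smul_eq_mul]
    ring
  rw [boxOp_apply, map_sum]
  simp_rw [hx]
  rw [← Finset.mul_sum, sum_Ico_neg_sub fun x => expect μ (siteFn h x * f),
    expect_siteFn_mul μ h hf (by simp), expect_siteFn_mul μ h hf (by simp), sub_self, mul_zero]

variable {μ} in
theorem DetailedBalance.exists_potential {n p q : ℝ} (hn : 0 < n) (hpq : p ≠ q)
    {r : Fin (κ + 1) → Fin (κ + 1) → ℝ} (hr : DetailedBalance r μ) (hμ : ∀ a, 0 < μ.real {a})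
    (hinv : ∀ f g : C(Config κ, ℝ), IsLocal f → (∀ η, g η = generator n p q r f η) →
      expect μ g = 0) :
    ∃ φ : Fin (κ + 1) → ℝ, ∀ a b, r b a - r a b = φ b - φ a := by
  -- With `f = 1{η_0 = a, η_1 = b}`, the bonds `{-1, 0}`, `{0, 1}` and `{1, 2}` contribute `φ(a)`,
  -- `r(b, a) - r(a, b)` and `-φ(b)`, up to a common nonzero factor. The outer sites `-1` and `2`
  -- are averaged out, which produces this `φ`.
  refine ⟨fun a => ∑ z, μ.real {z} * (r a z - r z a), fun a b => ?_⟩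
  let δ : Fin (κ + 1) → Fin (κ + 1) → ℝ := fun a z => if z = a then 1 else 0
  let f : C(Config κ, ℝ) := siteFn (δ a) 0 * siteFn (δ b) 1
  have hsite : ∀ (h : Fin (κ + 1) → ℝ) (x : ℤ), DependsOn (siteFn h x) ({x} : Set ℤ) :=
    fun h x η ξ hηξ => congrArg h (hηξ x rfl)
  have hfdep : DependsOn f ({0, 1} : Set ℤ) := by
    intro η ξ h
    change δ a (η 0) * δ b (η 1) = δ a (ξ 0) * δ b (ξ 1)
    rw [h 0 (by simp), h 1 (by simp)]
  have hδ : ∀ a, ∑ z, μ.real {z} * δ a z = μ.real {a} := fun a => by simp [δ]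
  have hfpos : 0 < expect μ f := by
    have h1 : expect μ (siteFn (δ b) 1) = μ.real {b} := by
      have := expect_siteFn_mul μ (δ b) (x := 1) (f := 1) (A := ∅) (fun _ _ _ => rfl) (by simp)
      rwa [mul_one, expect_one, mul_one, hδ] at this
    rw [expect_siteFn_mul μ (δ a) (hsite (δ b) 1) (by simp), h1, hδ]
    exact mul_pos (hμ a) (hμ b)
  have hfval : ∀ η : Config κ, f η ≠ 0 → η 0 = a ∧ η 1 = b := by
    intro η h
    change δ a (η 0) * δ b (η 1) ≠ 0 at h
    simpa [δ, and_comm] using h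
  have hgen := hinv f (∑ x ∈ ({-1, 0, 1} : Finset ℤ), bondOp n p q r x f)
    ⟨{0, 1}, by simpa using hfdep⟩ fun η => (generator_eq_sum n p q r hfdep (fun x hx => by
      simp only [Finset.mem_insert, Finset.mem_singleton, Set.mem_insert_iff,
        Set.mem_singleton_iff] at *
      omega) η).symm
  rw [map_sum] at hgen
  simp_rw [hr.expect_bondOp] at hgen
  rw [← Finset.mul_sum] at hgen
  have hne : n ^ 2 * (p - q) ≠ 0 := mul_ne_zero (by positivity) (sub_ne_zero.2 hpq)
  have hsum := (mul_eq_zero.1 hgen).resolve_left hne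
  rw [Finset.sum_insert (by decide), Finset.sum_insert (by decide), Finset.sum_singleton] at hsum
  have e1 : pairFn (fun a b => r b a - r a b) (-1) (-1 + 1) * f =
      siteFn (fun z => r a z - r z a) (-1) * f := by
    ext η
    change (r (η 0) (η (-1)) - r (η (-1)) (η 0)) * f η = (r a (η (-1)) - r (η (-1)) a) * f η
    by_cases h : f η = 0
    · rw [h, mul_zero, mul_zero]
    · rw [(hfval η h).1]
  have e2 : pairFn (fun a b => r b a - r a b) 0 (0 + 1) * f = (r b a - r a b) • f := by
    ext η
    change (r (η 1) (η 0) - r (η 0) (η 1)) * f η = (r b a - r a b) * f η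
    by_cases h : f η = 0
    · rw [h, mul_zero, mul_zero]
    · rw [(hfval η h).1, (hfval η h).2]
  have e3 : pairFn (fun a b => r b a - r a b) 1 (1 + 1) * f =
      siteFn (fun z => r z b - r b z) 2 * f := by
    ext η
    change (r (η 2) (η 1) - r (η 1) (η 2)) * f η = (r (η 2) b - r b (η 2)) * f η
    by_cases h : f η = 0
    · rw [h, mul_zero, mul_zero]
    · rw [(hfval η h).2]
  rw [e1, e2, e3, expect_siteFn_mul μ _ hfdep (by simp), expect_siteFn_mul μ _ hfdep (by simp),
    map_smul, smul_eq_mul, ← add_mul, ← add_mul] at hsum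
  have h0 := (mul_eq_zero.1 hsum).resolve_right hfpos.ne'
  have e4 : ∑ z, μ.real {z} * (r z b - r b z) = -∑ z, μ.real {z} * (r b z - r z b) := by
    rw [← Finset.sum_neg_distrib]
    exact Finset.sum_congr rfl fun z _ => by ring
  rw [e4] at h0
  linarith

end Product
-- The one-site marginal and the density.
theorem rateFactorial_pos {g : Fin (κ + 1) → ℝ} (hg : ∀ m, m ≠ 0 → 0 < g m)
    (m : Fin (κ + 1)) : 0 < rateFactorial g m :=
  Finset.prod_pos fun j hj => hg j (Finset.mem_Ioc.1 hj).1.ne'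

theorem rateFactorial_succ (g : Fin (κ + 1) → ℝ) (i : Fin κ) :
    rateFactorial g i.succ = g i.succ * rateFactorial g i.castSucc := by
  have e : Finset.Ioc 0 i.succ = insert i.succ (Finset.Ioc 0 i.castSucc) := by
    ext j
    simp only [Finset.mem_Ioc, Finset.mem_insert, Fin.lt_def, Fin.le_def, Fin.ext_iff,
      Fin.val_succ, Fin.val_castSucc, Fin.val_zero]
    omega
  rw [rateFactorial, e, Finset.prod_insert (by simp [Fin.lt_def, Fin.le_def])]
  rfl

section Marginal

variable {c d : Fin (κ + 1) → ℝ}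

theorem weight_pos (hc : ∀ m, m ≠ 0 → 0 < c m) (hd : ∀ m, m ≠ 0 → 0 < d m) {lam : ℝ}
    (hl : 0 < lam) (m : Fin (κ + 1)) : 0 < weight c d lam m :=
  div_pos (pow_pos hl _) (mul_pos (rateFactorial_pos hc m) (rateFactorial_pos hd _))

theorem partitionFn_pos (hc : ∀ m, m ≠ 0 → 0 < c m) (hd : ∀ m, m ≠ 0 → 0 < d m) {lam : ℝ}
    (hl : 0 < lam) : 0 < partitionFn c d lam :=
  Finset.sum_pos (fun m _ => weight_pos hc hd hl m) Finset.univ_nonempty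

/-- This ratio of consecutive weights is the source of detailed balance: applied at `i` and at `j`,
it makes both sides symmetric in `i` and `j`. -/
theorem weight_succ (hc : ∀ m, m ≠ 0 → 0 < c m) (hd : ∀ m, m ≠ 0 → 0 < d m) (lam : ℝ)
    (i : Fin κ) : weight c d lam i.succ * c i.succ =
      lam * d (Fin.rev i.castSucc) * weight c d lam i.castSucc := by
  have h1 := rateFactorial_succ c i
  have h2 : rateFactorial d (Fin.rev i.castSucc) =
      d (Fin.rev i.castSucc) * rateFactorial d (Fin.rev i.succ) := by
    rw [Fin.rev_castSucc, Fin.rev_succ, rateFactorial_succ]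
  have h3 := rateFactorial_pos hc i.castSucc
  have h4 := rateFactorial_pos hd (Fin.rev i.succ)
  have h5 := hc i.succ (Fin.succ_ne_zero i)
  have h6 := hd (Fin.rev i.castSucc) (by rw [Fin.rev_castSucc]; exact Fin.succ_ne_zero _)
  rw [weight, weight, h1, h2]
  simp only [Fin.val_succ, Fin.val_castSucc]
  field_simp
  rw [pow_succ']

theorem marginal_real_singleton (hc : ∀ m, m ≠ 0 → 0 < c m) (hd : ∀ m, m ≠ 0 → 0 < d m)
    {lam : ℝ} (hl : 0 < lam) (m : Fin (κ + 1)) :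
    (marginal c d lam).real {m} = weight c d lam m / partitionFn c d lam := by
  have h : marginal c d lam {m} = ENNReal.ofReal (weight c d lam m / partitionFn c d lam) := by
    rw [marginal, Measure.finsetSum_apply, Finset.sum_eq_single m]
    · simp
    · intro b _ hb
      simp [hb]
    · simp
  rw [Measure.real, h, ENNReal.toReal_ofReal]
  exact (div_pos (weight_pos hc hd hl m) (partitionFn_pos hc hd hl)).le

theorem isProbabilityMeasure_marginal (hc : ∀ m, m ≠ 0 → 0 < c m)
    (hd : ∀ m, m ≠ 0 → 0 < d m) {lam : ℝ} (hl : 0 < lam) :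
    IsProbabilityMeasure (marginal c d lam) := by
  have hZ := partitionFn_pos hc hd hl
  constructor
  rw [marginal, Measure.finsetSum_apply]
  simp only [Measure.smul_apply, measure_univ, smul_eq_mul, mul_one]
  rw [← ENNReal.ofReal_sum_of_nonneg fun m _ => (div_pos (weight_pos hc hd hl m) hZ).le,
    ← Finset.sum_div, ← partitionFn, div_self hZ.ne', ENNReal.ofReal_one]

theorem detailedBalance_marginal (hc0 : c 0 = 0) (hd0 : d 0 = 0) (hc : ∀ m, m ≠ 0 → 0 < c m)
    (hd : ∀ m, m ≠ 0 → 0 < d m) {lam : ℝ} (hl : 0 < lam) :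
    DetailedBalance (jumpRate c d) (marginal c d lam) where
  zero_left b := by simp [jumpRate, hc0]
  last_right a := by simp [jumpRate, hd0]
  balance i j := by
    simp only [marginal_real_singleton hc hd hl, jumpRate]
    have hi := weight_succ hc hd lam i
    have hj := weight_succ hc hd lam j
    calc _ = (weight c d lam i.succ * c i.succ) * weight c d lam j.castSucc *
          d (Fin.rev j.castSucc) / partitionFn c d lam ^ 2 := by ring
      _ = (weight c d lam j.succ * c j.succ) * weight c d lam i.castSucc *
          d (Fin.rev i.castSucc) / partitionFn c d lam ^ 2 := by rw [hi, hj]; ring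
      _ = _ := by ring

theorem density_eq (hc : ∀ m, m ≠ 0 → 0 < c m) (hd : ∀ m, m ≠ 0 → 0 < d m) {lam : ℝ}
    (hl : 0 < lam) : density c d lam =
      (∑ m : Fin (κ + 1), ((m : ℕ) : ℝ) * weight c d lam m) / partitionFn c d lam := by
  have := isProbabilityMeasure_marginal hc hd hl
  have h := expect_siteFn_mul (marginal c d lam) (fun a => ((a : ℕ) : ℝ)) (x := 0) (f := 1)
    (A := ∅) (fun _ _ _ => rfl) (by simp)
  rw [mul_one, expect_one, mul_one] at h
  rw [density, Finset.sum_div]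
  refine h.trans (Finset.sum_congr rfl fun a _ => ?_)
  rw [marginal_real_singleton hc hd hl]
  ring

theorem weight_eq_pow_mul (c d : Fin (κ + 1) → ℝ) (lam : ℝ) (m : Fin (κ + 1)) :
    weight c d lam m = lam ^ (m : ℕ) * weight c d 1 m := by
  rw [weight, weight, one_pow, mul_one_div]

theorem surjOn_density (hc : ∀ m, m ≠ 0 → 0 < c m) (hd : ∀ m, m ≠ 0 → 0 < d m) :
    Set.SurjOn (density c d) (Set.Ioi 0) (Set.Ioo 0 (κ : ℝ)) := by
  rintro ρ ⟨hρ0, hρκ⟩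
  have hw := weight_pos hc hd one_pos
  -- The density at `l > 0` is `ρ` exactly when `P l = 0`. Here `P 0 < 0`, and the reversed
  -- polynomial `Q`, with `P s⁻¹ = s⁻¹ ^ κ * Q s` and `Q 0 > 0`, shows that `P` is positive far out.
  -- The intermediate value theorem gives the root.
  let P : ℝ → ℝ := fun l => ∑ m : Fin (κ + 1), l ^ (m : ℕ) * (((m : ℕ) - ρ) * weight c d 1 m)
  let Q : ℝ → ℝ := fun s =>
    ∑ m : Fin (κ + 1), s ^ (κ - (m : ℕ)) * (((m : ℕ) - ρ) * weight c d 1 m)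
  have hP : Continuous P := by fun_prop
  have hQ : Continuous Q := by fun_prop
  have hP0 : P 0 < 0 := by
    have : P 0 = -ρ * weight c d 1 0 := by
      simp only [P]
      rw [Fin.sum_univ_succ]
      simp
    rw [this]
    exact mul_neg_of_neg_of_pos (neg_neg_of_pos hρ0) (hw 0)
  have hQ0 : 0 < Q 0 := by
    have : Q 0 = (κ - ρ) * weight c d 1 (Fin.last κ) := by
      simp only [Q]
      rw [Fin.sum_univ_castSucc, Finset.sum_eq_zero]
      · simp
      · intro i _
        rw [zero_pow (Nat.sub_ne_zero_of_lt (by simp)), zero_mul]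
    rw [this]
    exact mul_pos (sub_pos.2 hρκ) (hw _)
  obtain ⟨s, hQs, hs⟩ : ∃ s, 0 < Q s ∧ 0 < s :=
    ((((hQ.tendsto 0).eventually_const_lt hQ0).filter_mono nhdsWithin_le_nhds).and
      (self_mem_nhdsWithin (s := Set.Ioi (0 : ℝ)))).exists
  have hPs : 0 < P s⁻¹ := by
    have : P s⁻¹ = s⁻¹ ^ κ * Q s := by
      simp only [P, Q, Finset.mul_sum]
      refine Finset.sum_congr rfl fun m _ => ?_
      have hm : s⁻¹ ^ κ = s⁻¹ ^ (m : ℕ) * s⁻¹ ^ (κ - (m : ℕ)) := by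
        rw [← pow_add, Nat.add_sub_of_le (Nat.lt_succ_iff.1 m.2)]
      rw [← mul_assoc (s⁻¹ ^ κ), hm, mul_assoc (s⁻¹ ^ (m : ℕ)), inv_pow s (κ - m),
        inv_mul_cancel₀ (by positivity), mul_one]
    rw [this]
    positivity
  obtain ⟨l, hl, hPl⟩ := intermediate_value_Icc (inv_nonneg.2 hs.le) hP.continuousOn
    (show (0 : ℝ) ∈ Set.Icc (P 0) (P s⁻¹) from ⟨hP0.le, hPs.le⟩)
  have hl0 : 0 < l := lt_of_le_of_ne hl.1 fun h => by
    rw [← h] at hPl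
    exact hP0.ne hPl
  refine ⟨l, hl0, ?_⟩
  rw [density_eq hc hd hl0, div_eq_iff (partitionFn_pos hc hd hl0).ne', partitionFn,
    Finset.mul_sum, ← sub_eq_zero, ← Finset.sum_sub_distrib, ← hPl]
  refine Finset.sum_congr rfl fun m _ => ?_
  rw [weight_eq_pow_mul c d l]
  ring

/-- Surjectivity of the density is enough to place the chosen preimage in `(0, ∞)`. -/
theorem lambdaOf_pos (hc : ∀ m, m ≠ 0 → 0 < c m) (hd : ∀ m, m ≠ 0 → 0 < d m) {ρ : ℝ}
    (hρ : ρ ∈ Set.Ioo (0 : ℝ) κ) : 0 < lambdaOf c d ρ :=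
  Function.invFunOn_mem (surjOn_density hc hd hρ)

theorem isInvariant_nu_of_isGradient {n p q : ℝ} (hp : 0 ≤ p) (hq : 0 ≤ q) (hpq : p + q = 1)
    (hc0 : c 0 = 0) (hd0 : d 0 = 0) (hc : ∀ m, m ≠ 0 → 0 < c m) (hd : ∀ m, m ≠ 0 → 0 < d m)
    (hr : ∀ a b, 0 ≤ jumpRate c d a b) {S : ℝ≥0 → C(Config κ, ℝ) →ₗ[ℝ] C(Config κ, ℝ)}
    (hS : IsPEPSemigroup n p q (jumpRate c d) S) (hg : IsGradient (jumpRate c d)) {ρ : ℝ}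
    (hρ : ρ ∈ Set.Ioo (0 : ℝ) κ) : IsInvariant S (nu c d ρ) := by
  have hl := lambdaOf_pos hc hd hρ
  have := isProbabilityMeasure_marginal hc hd hl
  obtain ⟨h, hh⟩ := hg
  have hgrad : ∀ a b, jumpRate c d b a - jumpRate c d a b = 2 * (h b - h a) := by
    intro a b
    have := hh 0 fun z => if z = 0 then a else b
    simp only [symCurrent, if_true, zero_add, one_ne_zero, if_false] at this
    linarith
  obtain ⟨hM, hG⟩ := isPEPSemigroup_iff.1 hS
  exact (isLocalApproximation hp hq hpq hr).invariant hM hG (expect (marginal c d _))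
    fun m f hf => (detailedBalance_marginal hc0 hd0 hc hd hl).expect_boxOp_eq_zero hgrad n p q hf

theorem isGradient_of_isInvariant_nu {n p q : ℝ} (hn : 0 < n) (hpq : p ≠ q)
    (hc0 : c 0 = 0) (hd0 : d 0 = 0) (hc : ∀ m, m ≠ 0 → 0 < c m) (hd : ∀ m, m ≠ 0 → 0 < d m)
    {S : ℝ≥0 → C(Config κ, ℝ) →ₗ[ℝ] C(Config κ, ℝ)}
    (hS : IsPEPSemigroup n p q (jumpRate c d) S) {ρ : ℝ} (hρ : ρ ∈ Set.Ioo (0 : ℝ) κ)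
    (hinv : IsInvariant S (nu c d ρ)) : IsGradient (jumpRate c d) := by
  have hl := lambdaOf_pos hc hd hρ
  have := isProbabilityMeasure_marginal hc hd hl
  obtain ⟨φ, hφ⟩ := (detailedBalance_marginal hc0 hd0 hc hd hl).exists_potential hn hpq
    (fun a => by
      rw [marginal_real_singleton hc hd hl]
      exact div_pos (weight_pos hc hd hl a) (partitionFn_pos hc hd hl)) (p := p) (q := q)
    fun f g hf hg => by
      obtain ⟨g', hg', hgen⟩ := hS.generated f hf
      obtain rfl : g = g' := ContinuousMap.ext fun η => by rw [hg, hg']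
      -- Invariance makes the expectation of each difference quotient `(S t f - f) / t` vanish,
      -- hence also that of its limit.
      refine tendsto_nhds_unique
        (((expect (marginal c d (lambdaOf c d ρ))).continuous.tendsto g).comp hgen)
        (tendsto_const_nhds.congr fun t => ?_)
      have h : expect (marginal c d (lambdaOf c d ρ)) (S t f) = expect _ f := hinv t f
      rw [Function.comp_apply, map_smul, map_sub, h, sub_self, smul_zero]
  refine ⟨fun a => φ a / 2, fun x η => ?_⟩
  have := hφ (η x) (η (x + 1))
  rw [symCurrent]
  linarith

end Marginal

/-! ### Algebra of gradient rates. -/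

/-- The currents of the pairs `(m, 0)` and `(0, κ)` add up to that of `(m, κ)`. Since `c(0) = d(0) =
0`, each is a single product, and the common factor `c(κ)` cancels. -/
theorem rev_eq_sub_of_isGradient {c d : Fin (κ + 1) → ℝ} (hc0 : c 0 = 0) (hd0 : d 0 = 0)
    (hlast : c (Fin.last κ) ≠ 0) (hnorm : c (Fin.last κ) = d (Fin.last κ))
    (h : IsGradient (jumpRate c d)) (m : Fin (κ + 1)) :
    d (Fin.rev m) = c (Fin.last κ) - c m := by
  obtain ⟨h, hh⟩ := h
  have hgrad : ∀ a b, (1 / 2) * (c a * d (Fin.rev b) - c b * d (Fin.rev a)) = h a - h b := by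
    intro a b
    simpa [symCurrent, jumpRate] using hh 0 fun z => if z = 0 then a else b
  have h1 := hgrad m 0
  have h2 := hgrad m (Fin.last κ)
  have h3 := hgrad 0 (Fin.last κ)
  rw [Fin.rev_zero] at h1 h3
  rw [Fin.rev_last] at h2 h3
  rw [hc0, hd0, ← hnorm] at *
  refine mul_left_cancel₀ hlast ?_
  linarith

/-- The strict bound `c(m) < c(κ)` is the positivity of `d(κ - m)` for `m ≠ κ`. -/
theorem isGradientRate_of_rev_eq_sub {c d : Fin (κ + 1) → ℝ} (hκ : 1 ≤ κ) (hc0 : c 0 = 0)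
    (hc : ∀ m, m ≠ 0 → 0 < c m) (hd : ∀ m, m ≠ 0 → 0 < d m)
    (h : ∀ m, d (Fin.rev m) = c (Fin.last κ) - c m) : IsGradientRate (jumpRate c d) c where
  nonneg m := by
    by_cases hm : m = 0
    · rw [hm, hc0]
    · exact (hc m hm).le
  zero := hc0
  last_pos := hc _ fun e => by simp [Fin.ext_iff] at e; omega
  between m hm hm' := by
    refine ⟨hc m hm, ?_⟩
    have := hd (Fin.rev m) (by rwa [Ne, Fin.rev_eq_iff, Fin.rev_zero])
    rw [h] at this
    linarith
  rate a b := by rw [jumpRate, h]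

theorem IsGradientRate.isGradientWith {r : Fin (κ + 1) → Fin (κ + 1) → ℝ}
    {g : Fin (κ + 1) → ℝ} (h : IsGradientRate r g) :
    IsGradientWith r fun m => (1 / 2) * g (Fin.last κ) * g m := by
  intro x η
  rw [symCurrent, h.rate, h.rate]
  ring

end PEP

theorem theorem2p2 (κ : ℕ) (hκ : 1 ≤ κ) (n p q : ℝ) (hn : 0 < n)
    (hp : 0 ≤ p) (hq : 0 ≤ q) (hpq : p + q = 1) (hasym : p ≠ q)
    (c d : Fin (κ + 1) → ℝ)
    (hc0 : c 0 = 0) (hd0 : d 0 = 0)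
    (hc : ∀ m, m ≠ 0 → 0 < c m) (hd : ∀ m, m ≠ 0 → 0 < d m)
    (hnorm : c (Fin.last κ) = d (Fin.last κ)) :
    (∃! S : ℝ≥0 → C(PEP.Config κ, ℝ) →ₗ[ℝ] C(PEP.Config κ, ℝ),
      PEP.IsPEPSemigroup n p q (PEP.jumpRate c d) S) ∧
    (∀ S : ℝ≥0 → C(PEP.Config κ, ℝ) →ₗ[ℝ] C(PEP.Config κ, ℝ),
      PEP.IsPEPSemigroup n p q (PEP.jumpRate c d) S →
      List.TFAE [
        ∀ ρ ∈ Set.Ioo (0 : ℝ) κ, PEP.IsInvariant S (PEP.nu c d ρ),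
        PEP.IsGradient (PEP.jumpRate c d),
        ∀ m, d (Fin.rev m) = c (Fin.last κ) - c m,
        ∃ g : Fin (κ + 1) → ℝ, PEP.IsGradientRate (PEP.jumpRate c d) g]) ∧
    ((∀ m, d (Fin.rev m) = c (Fin.last κ) - c m) →
      PEP.IsGradientWith (PEP.jumpRate c d) fun m => (1 / 2) * c (Fin.last κ) * c m) ∧
    (∀ g : Fin (κ + 1) → ℝ, PEP.IsGradientRate (PEP.jumpRate c d) g →
      PEP.IsGradientWith (PEP.jumpRate c d) fun m => (1 / 2) * g (Fin.last κ) * g m) := by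
  have hnonneg : ∀ g : Fin (κ + 1) → ℝ, g 0 = 0 → (∀ m, m ≠ 0 → 0 < g m) → ∀ m, 0 ≤ g m := by
    intro g h0 hg m
    by_cases hm : m = 0
    · rw [hm, h0]
    · exact (hg m hm).le
  have hr : ∀ a b, 0 ≤ PEP.jumpRate c d a b := fun a b =>
    mul_nonneg (hnonneg c hc0 hc a) (hnonneg d hd0 hd _)
  have hκ0 : (0 : ℝ) < κ := by exact_mod_cast hκ
  have hlast : 0 < c (Fin.last κ) := hc _ fun e => by simp [Fin.ext_iff] at e; omega
  refine ⟨PEP.existsUnique_isPEPSemigroup hp hq hpq hr, fun S hS => ?_,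
    fun h => (PEP.isGradientRate_of_rev_eq_sub hκ hc0 hc hd h).isGradientWith,
    fun g hg => hg.isGradientWith⟩
  tfae_have 1 → 2 := fun h => by
    -- Any one density in `(0, κ)` would do.
    have hρ : (κ : ℝ) / 2 ∈ Set.Ioo (0 : ℝ) κ := ⟨by positivity, by linarith⟩
    exact PEP.isGradient_of_isInvariant_nu hn hasym hc0 hd0 hc hd hS hρ (h _ hρ)
  tfae_have 2 → 1 := fun h ρ hρ =>
    PEP.isInvariant_nu_of_isGradient hp hq hpq hc0 hd0 hc hd hr hS h hρ
  tfae_have 2 → 3 := fun h => PEP.rev_eq_sub_of_isGradient hc0 hd0 hlast.ne' hnorm h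
  tfae_have 3 → 4 := fun h => ⟨c, PEP.isGradientRate_of_rev_eq_sub hκ hc0 hc hd h⟩
  tfae_have 4 → 2 := fun ⟨_, hg⟩ => ⟨_, hg.isGradientWith⟩
  tfae_finish
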